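/- Let $X$ be a proper (i.e. locally finite) CAT(0) cube complex, that is, a simply connected cube complex in which the link of every vertex is a flag complex, and let $G$ be a group acting properly and cocompactly on $X$ by cubical automorphisms. Distances between vertices are taken in the $1$-skeleton of $X$. A (nonempty) subcomplex is convex if it is full and its $1$-skeleton is metrically convex in $X^{(1)}$. For convex subcomplexes $F,F'$, let $\mathfrak g_F(F')\subseteq F$ be the image of $F'$ under the cubical gate map $X\to F$ that sends each vertex to the unique closest vertex of $F$. Call $F,F'$ parallel if they are crossed by the same hyperplanes of $X$. A combinatorial hyperplane is one of the two subcomplexes $H\times\{\pm\frac12\}$ of the carrier $\mathcal N(H)\cong H\times[-\frac12,\frac12]$ of a hyperplane $H$ of $X$. The hyperclosure $\mathfrak F$ of $X$ is the intersection of all sets $\mathfrak F'$ of convex subcomplexes of $X$ such that: (1) $X\in\mathfrak F'$ and every combinatorial hyperplane of $X$ is in $\mathfrak F'$; (2) if $F,F'\in\mathfrak F'$ then $\mathfrak g_F(F')\in\mathfrak F'$; (3) if $F\in\mathfrak F'$ and $F'$ is a convex subcomplex parallel to $F$, then $F'\in\mathfrak F'$. Let $\mathfrak F_0=\{X\}$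 and, for $n\ge 1$, let $\mathfrak F_n$ be the set of those elements of $\mathfrak F$ that are of the form $\mathfrak g_H(F)$ with $F\in\mathfrak F_{n-1}$ and $H$ a combinatorial hyperplane. Then for every $n\ge 1$ and every $F\in\mathfrak F_n$, the stabiliser $\mathrm{Stab}_G(F)$ acts cocompactly on $F$. Moreover, $\mathrm{Stab}_G(F)$ acts cocompactly on $F$ for every $F\in\mathfrak F$. -/

import Mathlib

open scoped Pointwise

universe u v

/-- The set of vertices of the face of the combinatorial `n`-cube `{0,1}^n` that is cut out by
prescribing the coordinates `i` with `σ i ≠ none`. -/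
def cubeFace {n : ℕ} (σ : Fin n → Option Bool) : Set (Fin n → Bool) :=
  {x | ∀ i b, σ i = some b → x i = b}

/-- A cube complex with vertex set `V`. As usual, cubes are embedded and two cubes meet, if at all,
in a common face; hence a cube is determined by its (finite) set of vertices, and the complex is
recorded by the family of the vertex sets of its (closed) cubes.
`exists_chart` says that each cube `c` is a copy of some `{0,1}^n`, in such a way that the cubes
contained in `c` are exactly the faces of `c`. -/
@[ext]
structure CubeComplex (V : Type u) where
  cubes : Set (Set V)
  singleton_mem : ∀ v : V, {v} ∈ cubes
  exists_chart : ∀ c ∈ cubes, ∃ (n : ℕ) (φ : (Fin n → Bool) → V),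
    Function.Injective φ ∧ Set.range φ = c ∧
      ∀ d : Set V, d ⊆ c → (d ∈ cubes ↔ ∃ σ : Fin n → Option Bool, d = φ '' cubeFace σ)
  inter_mem : ∀ c ∈ cubes, ∀ d ∈ cubes, (c ∩ d).Nonempty → c ∩ d ∈ cubes

/-- A simplicial complex is flag if every finite nonempty set of pairwise adjacent vertices spans a
simplex. -/
def IsFlagComplex {ι : Type u} (K : AbstractSimplicialComplex ι) : Prop :=
  ∀ s : Finset ι, s.Nonempty →
    (∀ a ∈ s, ∀ b ∈ s, a ≠ b → ∃ t ∈ K.faces, (t : Set ι) = {a, b}) → s ∈ K.faces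

namespace CubeComplex

variable {V : Type u} (X : CubeComplex V)

/-- The graph `X^(1)`. Distances between vertices are taken in this graph. -/
def skeleton : SimpleGraph V where
  Adj a b := a ≠ b ∧ ({a, b} : Set V) ∈ X.cubes
  symm := ⟨fun a b h => ⟨h.1.symm, by rw [Set.pair_comm]; exact h.2⟩⟩
  loopless := ⟨fun _ h => h.1 rfl⟩

/-- `a, b, c, d` are the vertices, in cyclic order, of a `2`-cube. -/
def IsSquare (a b c d : V) : Prop :=
  X.skeleton.Adj a b ∧ X.skeleton.Adj b c ∧ X.skeleton.Adj d c ∧ X.skeleton.Adj a d ∧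
    a ≠ c ∧ b ≠ d ∧ ({a, b, c, d} : Set V) ∈ X.cubes

/-- The link of a vertex `v`: its vertices are the edges at `v` (given by their other ends), its
simplices are spanned by the sets of edges at `v` that lie in a common cube. -/
def link (v : V) : AbstractSimplicialComplex (X.skeleton.neighborSet v) where
  faces := {s | s.Nonempty ∧ ∃ c ∈ X.cubes, v ∈ c ∧ ∀ w ∈ s, (w : V) ∈ c}
  isRelLowerSet_faces := by
    rintro s ⟨hs, c, hc, hv, hw⟩
    exact ⟨hs, fun t hts ht => ⟨ht, c, hc, hv, fun w hwt => hw w (hts hwt)⟩⟩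
  singleton_mem := fun w =>
    ⟨Finset.singleton_nonempty w, {v, (w : V)}, w.2.2, by simp, by simp⟩

/-- Homotopy, relative to the end points, of edge paths in `X`: the equivalence relation generated
by insertion and deletion of backtracks and by pushing a path across a `2`-cube. -/
inductive Homotopic : ∀ {a b : V}, X.skeleton.Walk a b → X.skeleton.Walk a b → Prop
  | refl {a b : V} (p : X.skeleton.Walk a b) : Homotopic p p
  | symm {a b : V} {p q : X.skeleton.Walk a b} : Homotopic p q → Homotopic q p
  | trans {a b : V} {p q r : X.skeleton.Walk a b} :
      Homotopic p q → Homotopic q r → Homotopic p r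
  | cons {a b c : V} (h : X.skeleton.Adj a b) {p q : X.skeleton.Walk b c} :
      Homotopic p q → Homotopic (.cons h p) (.cons h q)
  | backtrack {a b c : V} (h : X.skeleton.Adj a b) (p : X.skeleton.Walk a c) :
      Homotopic (.cons h (.cons h.symm p)) p
  | square {a b c d e : V} (h : X.IsSquare a b c d) (p : X.skeleton.Walk c e) :
      Homotopic (.cons h.1 (.cons h.2.1 p)) (.cons h.2.2.2.1 (.cons h.2.2.1 p))

/-- `X` is simply connected: it is (nonempty and) connected and its edge-path group is trivial. -/
def IsSimplyConnected : Prop :=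
  X.skeleton.Connected ∧ ∀ (a : V) (p : X.skeleton.Walk a a), X.Homotopic p .nil

/-- A CAT(0) cube complex: a simply connected cube complex in which the link of every vertex is a
flag complex. -/
def IsCAT0 : Prop :=
  X.IsSimplyConnected ∧ ∀ v : V, IsFlagComplex (X.link v)

/-- `X` is proper, i.e. locally finite. -/
def IsProper : Prop :=
  ∀ v : V, {c ∈ X.cubes | v ∈ c}.Finite

/-- A subcomplex: a set of cubes of `X` that contains all faces of its cubes. -/
@[ext]
structure Subcomplex where
  cubes : Set (Set V)
  subset : cubes ⊆ X.cubes
  face_mem : ∀ c ∈ cubes, ∀ d ∈ X.cubes, d ⊆ c → d ∈ cubes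

/-- `X` as a subcomplex of itself. -/
def whole : X.Subcomplex where
  cubes := X.cubes
  subset := subset_rfl
  face_mem := fun _ _ _ hd _ => hd

namespace Subcomplex

variable {X}

/-- The set of vertices of a subcomplex. -/
def verts (Y : X.Subcomplex) : Set V := {v | {v} ∈ Y.cubes}

/-- The `1`-skeleton of a subcomplex, as a graph on all of `V`. -/
def skeleton (Y : X.Subcomplex) : SimpleGraph V where
  Adj a b := a ≠ b ∧ ({a, b} : Set V) ∈ Y.cubes
  symm := ⟨fun a b h => ⟨h.1.symm, by rw [Set.pair_comm]; exact h.2⟩⟩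
  loopless := ⟨fun _ h => h.1 rfl⟩

/-- A subcomplex is full if it contains each cube whose vertices it contains. -/
def IsFull (Y : X.Subcomplex) : Prop :=
  ∀ c ∈ X.cubes, c ⊆ Y.verts → c ∈ Y.cubes

/-- A (nonempty) convex subcomplex: it is full and its `1`-skeleton contains all vertices on all
geodesics of `X^(1)` between its vertices. -/
def IsConvex (Y : X.Subcomplex) : Prop :=
  Y.verts.Nonempty ∧ Y.IsFull ∧
    ∀ a ∈ Y.verts, ∀ b ∈ Y.verts, ∀ z : V,
      X.skeleton.dist a z + X.skeleton.dist z b = X.skeleton.dist a b → z ∈ Y.verts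

/-- The connected component of the vertex `v` in the subcomplex `Y`. -/
def component (Y : X.Subcomplex) (v : V) : X.Subcomplex where
  cubes := {c ∈ Y.cubes | ∀ w ∈ c, Y.skeleton.Reachable v w}
  subset := fun _ hc => Y.subset hc.1
  face_mem := fun c hc d hd hdc => ⟨Y.face_mem c hc.1 d hd hdc, fun w hw => hc.2 w (hdc hw)⟩

/-- `y` is a gate of the vertex `x` in `Y`, i.e. a vertex of `Y` that is closest to `x`
(for convex `Y` in a CAT(0) cube complex there is exactly one). -/
def IsGate (Y : X.Subcomplex) (x y : V) : Prop :=
  y ∈ Y.verts ∧ ∀ z ∈ Y.verts, X.skeleton.dist x y ≤ X.skeleton.dist x z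

/-- The subcomplex `𝔤_Y(Z)`, the image of `Z` under the cubical gate map to `Y`: its cubes are the
faces of the cubes `𝔤_Y(c)`, where `c` is a cube of `Z` and where `𝔤_Y(c)` is the cube of `Y`
whose vertices are the gates of the vertices of `c`. -/
def gate (Y Z : X.Subcomplex) : X.Subcomplex where
  cubes := {d ∈ X.cubes | ∃ c ∈ Z.cubes, ∀ y ∈ d, ∃ x ∈ c, Y.IsGate x y}
  subset := fun _ hd => hd.1
  face_mem := by
    rintro c ⟨_, b, hb, h⟩ d hd hdc
    exact ⟨hd, b, hb, fun y hy => h y (hdc hy)⟩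

end Subcomplex

/-- Two edges are opposite edges of some `2`-cube. -/
def Opposite (e f : Sym2 V) : Prop :=
  ∃ a b c d : V, X.IsSquare a b c d ∧ e = s(a, b) ∧ f = s(d, c)

/-- A hyperplane, recorded by the set of the edges that it crosses: a class of the equivalence
relation on edges that is generated by being opposite in a `2`-cube. -/
def IsHyperplane (H : Set (Sym2 V)) : Prop :=
  ∃ e ∈ X.skeleton.edgeSet, H = {f | Relation.EqvGen X.Opposite e f}

/-- The hyperplane `H` meets the cube `c` (i.e. contains a midcube of `c`). -/
def MeetsCube (H : Set (Sym2 V)) (c : Set V) : Prop :=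
  ∃ a ∈ c, ∃ b ∈ c, s(a, b) ∈ H

/-- The carrier of the hyperplane `H`: the union of the closed cubes that meet `H`. -/
def carrier (H : Set (Sym2 V)) : X.Subcomplex where
  cubes := {d ∈ X.cubes | ∃ c ∈ X.cubes, d ⊆ c ∧ MeetsCube H c}
  subset := fun _ hd => hd.1
  face_mem := by
    rintro c ⟨_, b, hb, hcb, h⟩ d hd hdc
    exact ⟨hd, b, hb, hdc.trans hcb, h⟩

/-- The subcomplex of the carrier `H × [-1/2, 1/2]` of `H` formed by the cubes that do not meet
`H`, that is `H × {-1/2, 1/2}`. -/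
def carrierBoundary (H : Set (Sym2 V)) : X.Subcomplex where
  cubes := {d ∈ (X.carrier H).cubes | ¬ MeetsCube H d}
  subset := fun _ hd => (X.carrier H).subset hd.1
  face_mem := by
    rintro c ⟨hc, hm⟩ d hd hdc
    refine ⟨(X.carrier H).face_mem c hc d hd hdc, ?_⟩
    rintro ⟨a, ha, b, hb, h⟩
    exact hm ⟨a, hdc ha, b, hdc hb, h⟩

/-- A combinatorial hyperplane: one of the two subcomplexes `H × {1/2}`, `H × {-1/2}` of the carrier
of a hyperplane `H`, i.e. a connected component of `H × {-1/2, 1/2}`. -/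
def IsCombinatorialHyperplane (Y : X.Subcomplex) : Prop :=
  ∃ H : Set (Sym2 V), X.IsHyperplane H ∧
    ∃ v ∈ (X.carrierBoundary H).verts, Y = (X.carrierBoundary H).component v

/-- Two subcomplexes are parallel if they are crossed by the same hyperplanes. -/
def Parallel (Y Z : X.Subcomplex) : Prop :=
  ∀ H : Set (Sym2 V), X.IsHyperplane H →
    ((∃ c ∈ Y.cubes, MeetsCube H c) ↔ ∃ c ∈ Z.cubes, MeetsCube H c)

/-- The sets of convex subcomplexes that contain `X` and all combinatorial hyperplanes and are
closed under gate projections and under parallelism. -/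
structure IsHyperclosed (𝓕 : Set X.Subcomplex) : Prop where
  convex : ∀ F ∈ 𝓕, F.IsConvex
  whole_mem : X.whole ∈ 𝓕
  hyperplane_mem : ∀ H, X.IsCombinatorialHyperplane H → H ∈ 𝓕
  gate_mem : ∀ F ∈ 𝓕, ∀ F' ∈ 𝓕, F.gate F' ∈ 𝓕
  parallel_mem : ∀ F ∈ 𝓕, ∀ F' : X.Subcomplex, F'.IsConvex → X.Parallel F' F → F' ∈ 𝓕

/-- The hyperclosure of `X`: the intersection of all sets of convex subcomplexes as above. -/
def hyperclosure : Set X.Subcomplex :=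
  {F | ∀ 𝓕 : Set X.Subcomplex, X.IsHyperclosed 𝓕 → F ∈ 𝓕}

/-- The grading of the hyperclosure: `𝔉_0 = {X}`, and `𝔉_(n+1)` consists of the elements of the
hyperclosure of the form `𝔤_H(F)` with `H` a combinatorial hyperplane and `F ∈ 𝔉_n`. -/
def grade : ℕ → Set X.Subcomplex
  | 0 => {X.whole}
  | n + 1 => {F ∈ X.hyperclosure | ∃ H F' : X.Subcomplex,
      X.IsCombinatorialHyperplane H ∧ F' ∈ grade n ∧ F = H.gate F'}

section Action

variable (G : Type v) [Group G] [MulAction G V]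

/-- `G` acts on `X` by automorphisms of the cube complex. -/
def IsCubicalAction : Prop :=
  ∀ (g : G), ∀ c ∈ X.cubes, g • c ∈ X.cubes

variable (V) in
/-- The action is proper: only finitely many group elements move a given finite
subcomplex (with vertex set `K`) to one that meets it. -/
def IsProperAction : Prop :=
  ∀ K : Set V, K.Finite → {g : G | (g • K ∩ K).Nonempty}.Finite

variable {X} {G}

/-- The stabiliser of a subcomplex. -/
def Subcomplex.stabilizer (Y : X.Subcomplex) : Subgroup G :=
  MulAction.stabilizer G Y.cubes

/-- The subgroup `S` acts cocompactly on `Y`: the translates by `S` of some finite set of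
cubes of `Y` cover `Y`. -/
def ActsCocompactly (S : Subgroup G) (Y : X.Subcomplex) : Prop :=
  ∃ K : Set (Set V), K.Finite ∧ K ⊆ Y.cubes ∧ ∀ c ∈ Y.cubes, ∃ g ∈ S, ∃ k ∈ K, c = g • k

end Action

end CubeComplex

/-! The hyperclosure is an intersection, so it is enough that one particular family is hyperclosed:
the convex subcomplexes whose stabiliser acts cocompactly (`isHyperclosed_cocompact`). The positive
grades are part of the hyperclosure by definition.

Cocompactness is always obtained from `actsCocompactly_of_types`: give the vertices finitely many
types such that vertices of equal type differ by an element of the stabiliser. For a combinatorial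
hyperplane, the type is a pair of vertices from a finite set representing an edge that leaves the
halfspace. For a gate image, mutual gates in `F` and `F'` are at a constant distance. Hence if `g`
and `g'` in the two stabilisers bring them to representatives, properness leaves finitely many
values for `g⁻¹ * g'`, and equal values produce an element of both stabilisers. For `F'` parallel to
`F`, all vertices of `F'` are equally far from `F`, so `Stab F` moves them into a finite set. An
element of `Stab F` that carries one vertex of `F'` to another sends `F'` to a parallel copy sharing
a vertex with it, hence to `F'` itself.

The geometry rests on a normal form for edge paths. Flag links complete three squares at a corner to
a cube, which gives a diamond property for pushing paths across squares. As in van der Waerden's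
argument for words, edges act on classes of reduced paths; simple connectivity then makes reduced
paths with common ends equivalent (`IsCAT0.squareEquiv`). This yields bipartiteness
(`IsCAT0.dist_ne`) and the quadrangle condition (`IsCAT0.quadrangle`). Halfspaces, gates and
parallelism follow from these two by arithmetic with distances; flagness returns only to assemble
cubes. -/

namespace CubeComplex

variable {V : Type u} {X : CubeComplex V}

/-! ### Cubes, squares and the link condition -/

/-- A chart of the cube `c` in which the vertex `v` corresponds to the empty set; the faces
correspond to the intervals of the Boolean lattice. -/
structure BasedChart (X : CubeComplex V) (c : Set V) (v : V) where
  n : ℕ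
  toFun : Finset (Fin n) → V
  inj : Function.Injective toFun
  range_eq : Set.range toFun = c
  base : toFun ∅ = v
  face_iff : ∀ d : Set V, d ⊆ c → (d ∈ X.cubes ↔ ∃ A B, A ⊆ B ∧ d = toFun '' Set.Icc A B)

theorem nonempty_basedChart {c : Set V} (hc : c ∈ X.cubes) {v : V} (hv : v ∈ c) :
    Nonempty (BasedChart X c v) := by
  obtain ⟨n, φ, hinj, hrange, hface⟩ := X.exists_chart c hc
  obtain ⟨x₀, rfl⟩ : v ∈ Set.range φ := hrange ▸ hv
  -- Flip the coordinates of `x₀` that lie in `s`; this moves the base vertex to `∅`.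
  set E : Finset (Fin n) → (Fin n → Bool) := fun s i => xor (x₀ i) (decide (i ∈ s)) with hE
  have hEinj : Function.Injective E := by
    intro s t h
    ext i
    have := congrFun h i
    simpa [hE] using this
  have hEsurj : Function.Surjective E := by
    intro x
    refine ⟨Finset.univ.filter fun i => x i ≠ x₀ i, ?_⟩
    ext i
    cases hx : x i <;> cases hx₀ : x₀ i <;> simp [hE, hx, hx₀]
  refine ⟨⟨n, φ ∘ E, hinj.comp hEinj, by rw [hEsurj.range_comp, hrange], ?_, ?_⟩⟩
  · simp [hE]
  · intro d hd
    rw [hface d hd]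
    constructor
    · rintro ⟨σ, rfl⟩
      -- The lower end collects the coordinates forced to differ from `x₀`, the upper end those not
      -- forced to agree with it.
      refine ⟨Finset.univ.filter fun i => σ i = some (!x₀ i),
        Finset.univ.filter fun i => σ i ≠ some (x₀ i), ?_, ?_⟩
      · intro i
        cases hx₀ : x₀ i <;> simp [hx₀] <;> intro h <;> simp [h]
      · rw [Set.image_comp]
        congr 1
        ext x
        obtain ⟨s, rfl⟩ := hEsurj x
        rw [hEinj.mem_set_image]
        simp only [cubeFace, Set.mem_ofPred_eq, Set.mem_Icc, Finset.subset_iff, Finset.mem_filter, Finset.mem_univ, true_and, hE]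
        rw [← forall_and]
        refine forall_congr' fun i => ?_
        by_cases hi : i ∈ s <;> rcases hσ : σ i with _ | b <;> cases hx₀ : x₀ i <;>
          simp [hi]
    · rintro ⟨A, B, hAB, rfl⟩
      refine ⟨fun i => if i ∈ A then some (!x₀ i) else if i ∈ B then none else some (x₀ i), ?_⟩
      rw [Set.image_comp]
      congr 1
      ext x
      obtain ⟨s, rfl⟩ := hEsurj x
      rw [hEinj.mem_set_image]
      simp only [cubeFace, Set.mem_ofPred_eq, Set.mem_Icc, Finset.subset_iff, hE]
      rw [← forall_and]
      refine forall_congr' fun i => ?_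
      have := @hAB i
      by_cases hi : i ∈ s <;> by_cases hA : i ∈ A <;> by_cases hB : i ∈ B <;>
        simp_all

theorem nonempty_of_mem_cubes {c : Set V} (hc : c ∈ X.cubes) : c.Nonempty := by
  obtain ⟨n, φ, -, hrange, -⟩ := X.exists_chart c hc
  exact hrange ▸ Set.range_nonempty φ

theorem finite_of_mem_cubes {c : Set V} (hc : c ∈ X.cubes) : c.Finite := by
  obtain ⟨n, φ, -, hrange, -⟩ := X.exists_chart c hc
  exact hrange ▸ Set.finite_range φ

theorem exists_ncard_eq_two_pow {c : Set V} (hc : c ∈ X.cubes) : ∃ n : ℕ, c.ncard = 2 ^ n := by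
  obtain ⟨n, φ, hinj, hrange, -⟩ := X.exists_chart c hc
  refine ⟨n, ?_⟩
  rw [← hrange, ← Set.image_univ, Set.ncard_image_of_injective _ hinj, Set.ncard_univ]
  simp

namespace BasedChart

variable {c : Set V} {v : V} (ψ : BasedChart X c v)

theorem mem (s : Finset (Fin ψ.n)) : ψ.toFun s ∈ c :=
  ψ.range_eq.subset (Set.mem_range_self s)

theorem exists_eq {w : V} (hw : w ∈ c) : ∃ s, ψ.toFun s = w :=
  ψ.range_eq.superset hw

theorem image_Icc_mem {A B : Finset (Fin ψ.n)} (h : A ⊆ B) :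
    ψ.toFun '' Set.Icc A B ∈ X.cubes :=
  (ψ.face_iff _ (by rintro _ ⟨s, -, rfl⟩; exact ψ.mem s)).2 ⟨A, B, h, rfl⟩

theorem base_mem (ψ : BasedChart X c v) : v ∈ c :=
  (congrArg (· ∈ c) ψ.base).mp (ψ.mem ∅)

theorem adj_insert {s : Finset (Fin ψ.n)} {i : Fin ψ.n} (hi : i ∉ s) :
    X.skeleton.Adj (ψ.toFun s) (ψ.toFun (insert i s)) := by
  refine ⟨fun h => hi (by rw [ψ.inj h]; simp), ?_⟩
  convert ψ.image_Icc_mem (Finset.subset_insert i s)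
  rw [← Set.image_pair]
  congr 1
  ext t
  simp only [Set.mem_insert_iff, Set.mem_singleton_iff, Set.mem_Icc]
  constructor
  · rintro (rfl | rfl) <;> simp
  · rintro ⟨h1, h2⟩
    by_cases hit : i ∈ t
    · right
      exact h2.antisymm (Finset.insert_subset hit h1)
    · left
      exact ((Finset.subset_insert_iff_of_notMem hit).1 h2).antisymm h1

theorem adj_base_singleton (i : Fin ψ.n) : X.skeleton.Adj v (ψ.toFun {i}) := by
  have := ψ.adj_insert (Finset.notMem_empty i)
  rwa [ψ.base] at this

theorem exists_eq_singleton {w : V} (hw : w ∈ c) (h : X.skeleton.Adj v w) :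
    ∃ i, ψ.toFun {i} = w := by
  obtain ⟨s, rfl⟩ := ψ.exists_eq hw
  have hsub : ({v, ψ.toFun s} : Set V) ⊆ c := by
    rintro x (rfl | rfl)
    · exact ψ.base_mem
    · exact hw
  obtain ⟨A, B, -, hd⟩ := (ψ.face_iff _ hsub).1 h.2
  have hv : ψ.toFun ∅ ∈ ψ.toFun '' Set.Icc A B := by rw [ψ.base, ← hd]; simp
  have hs : ψ.toFun s ∈ ψ.toFun '' Set.Icc A B := hd ▸ by simp
  rw [ψ.inj.mem_set_image] at hv
  rw [ψ.inj.mem_set_image] at hs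
  obtain ⟨i, hi⟩ : s.Nonempty := by
    rw [Finset.nonempty_iff_ne_empty]
    rintro rfl
    exact h.1 ψ.base.symm
  have hi' : ψ.toFun {i} ∈ ({v, ψ.toFun s} : Set V) := by
    rw [hd, ψ.inj.mem_set_image]
    exact ⟨hv.1.trans (Finset.empty_subset _), (Finset.singleton_subset_iff.2 hi).trans hs.2⟩
  rcases hi' with h' | h'
  · exact absurd (ψ.inj (h'.trans ψ.base.symm)) (by simp)
  · exact ⟨i, h'⟩

theorem isSquare {s : Finset (Fin ψ.n)} {i j : Fin ψ.n} (hij : i ≠ j) (hi : i ∉ s) (hj : j ∉ s) :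
    X.IsSquare (ψ.toFun s) (ψ.toFun (insert i s)) (ψ.toFun (insert i (insert j s)))
      (ψ.toFun (insert j s)) := by
  have hji : j ∉ insert i s := by simp [hij.symm, hj]
  have hij' : i ∉ insert j s := by simp [hij, hi]
  refine ⟨ψ.adj_insert hi, ?_, ψ.adj_insert hij', ψ.adj_insert hj, ?_, ?_, ?_⟩
  · rw [Finset.insert_comm]; exact ψ.adj_insert hji
  · intro h
    apply hi
    rw [ψ.inj h]
    simp
  · intro h
    apply hij'
    rw [← ψ.inj h]
    simp
  · convert ψ.image_Icc_mem (A := s) (B := insert i (insert j s)) (fun x hx => by simp [hx])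
    ext x
    constructor
    · rintro (rfl | rfl | rfl | rfl)
      all_goals
        refine ⟨_, ⟨?_, ?_⟩, rfl⟩ <;> intro x hx <;> simp_all
      tauto
    · rintro ⟨t, ⟨h1, h2⟩, rfl⟩
      simp only [Set.mem_insert_iff, Set.mem_singleton_iff, ψ.inj.eq_iff]
      simp only [Finset.subset_iff, Finset.mem_insert] at h1 h2
      simp only [Finset.ext_iff, Finset.mem_insert]
      by_cases hit : i ∈ t <;> by_cases hjt : j ∈ t
      · right; right; left; grind
      · right; left; grind
      · right; right; right; grind
      · left; grind

/-- The intersection `c ∩ c'` is a face of `c` through the base vertex, i.e. an interval starting at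
`∅`; as it contains all singletons, it is everything. -/
theorem subset_of_base_mem {c' : Set V} (hc : c ∈ X.cubes) (hc' : c' ∈ X.cubes) (hv : v ∈ c')
    (h : ∀ i, ψ.toFun {i} ∈ c') : c ⊆ c' := by
  obtain ⟨A, B, -, hd⟩ := (ψ.face_iff _ Set.inter_subset_left).1
    (X.inter_mem c hc c' hc' ⟨v, ψ.base_mem, hv⟩)
  have hv' : ψ.toFun ∅ ∈ ψ.toFun '' Set.Icc A B := by
    rw [ψ.base, ← hd]; exact ⟨ψ.base_mem, hv⟩
  rw [ψ.inj.mem_set_image] at hv'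
  intro w hw
  obtain ⟨s, rfl⟩ := ψ.exists_eq hw
  have hs : ψ.toFun s ∈ c ∩ c' := by
    rw [hd, ψ.inj.mem_set_image]
    refine ⟨hv'.1.trans (Finset.empty_subset _), fun i hi => ?_⟩
    have hi' : ψ.toFun {i} ∈ ψ.toFun '' Set.Icc A B := hd ▸ ⟨ψ.mem _, h i⟩
    rw [ψ.inj.mem_set_image] at hi'
    exact hi'.2 (Finset.mem_singleton_self i)
  exact hs.2

end BasedChart

namespace IsSquare

variable {a b c d d' : V}

theorem symm (h : X.IsSquare a b c d) : X.IsSquare a d c b := by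
  obtain ⟨h1, h2, h3, h4, h5, h6, h7⟩ := h
  refine ⟨h4, h3, h2, h1, h5, h6.symm, ?_⟩
  convert h7 using 1
  ext; simp; tauto

theorem rotate (h : X.IsSquare a b c d) : X.IsSquare b c d a := by
  obtain ⟨h1, h2, h3, h4, h5, h6, h7⟩ := h
  refine ⟨h2, h3.symm, h4, h1.symm, h6, h5.symm, ?_⟩
  convert h7 using 1
  ext; simp; tauto

theorem ncard_eq (h : X.IsSquare a b c d) : ({a, b, c, d} : Set V).ncard = 4 := by
  obtain ⟨h1, h2, h3, h4, h5, h6, h7⟩ := h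
  rw [Set.ncard_insert_of_notMem, Set.ncard_insert_of_notMem, Set.ncard_pair h3.1.symm]
  · simp [h2.1, h6]
  · simp [h1.1, h5, h4.1]

/-- A cube that contains three vertices of a square contains the square. -/
theorem mem_of_mem (h : X.IsSquare a b c d) {k : Set V} (hk : k ∈ X.cubes) (ha : a ∈ k)
    (hb : b ∈ k) (hc : c ∈ k) : d ∈ k := by
  have hQ := h.ncard_eq
  have hfin : ({a, b, c, d} : Set V).Finite := by simp
  have hi := X.inter_mem _ h.2.2.2.2.2.2 k hk ⟨a, by simp, ha⟩
  obtain ⟨n, hn⟩ := exists_ncard_eq_two_pow hi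
  have h3 : ({a, b, c} : Set V).ncard = 3 := by
    rw [Set.ncard_insert_of_notMem, Set.ncard_pair h.2.1.1]
    simp [h.1.1, h.2.2.2.2.1]
  have hle : 3 ≤ ({a, b, c, d} ∩ k : Set V).ncard := by
    rw [← h3]
    refine Set.ncard_le_ncard ?_ (hfin.inter_of_left _)
    rintro x (rfl | rfl | rfl) <;> simp [*]
  have hle' : ({a, b, c, d} ∩ k : Set V).ncard ≤ 4 := by
    rw [← hQ]
    exact Set.ncard_le_ncard Set.inter_subset_left hfin
  -- The intersection is a cube, so its cardinality is a power of two; three is excluded.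
  have h4 : ({a, b, c, d} ∩ k : Set V).ncard = 4 := by
    rw [hn] at hle hle' ⊢
    have : n < 3 := by
      by_contra! hcon
      have := Nat.pow_le_pow_right (n := 2) (by norm_num) hcon
      omega
    interval_cases n <;> omega
  have heq := Set.eq_of_subset_of_ncard_le (Set.inter_subset_left (s := {a, b, c, d}) (t := k))
    (by rw [h4, hQ]) hfin
  have hd : d ∈ ({a, b, c, d} ∩ k : Set V) := by rw [heq]; simp
  exact hd.2

theorem unique (h : X.IsSquare a b c d) (h' : X.IsSquare a b c d') : d = d' := by
  have := h.mem_of_mem h'.2.2.2.2.2.2 (by simp) (by simp) (by simp)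
  rcases this with e | e | e | e
  · exact absurd e.symm h.2.2.2.1.1
  · exact absurd e.symm h.2.2.2.2.2.1
  · exact absurd e h.2.2.1.1
  · exact e

end IsSquare

/-- Pairwise adjacent neighbours in the link of a vertex lie in a common cube. -/
theorem exists_cube_of_flag (hX : ∀ v, IsFlagComplex (X.link v)) {v : V} {s : Set V}
    (hs : s.Finite) (hadj : ∀ a ∈ s, X.skeleton.Adj v a)
    (hpair : ∀ a ∈ s, ∀ b ∈ s, a ≠ b → ∃ c ∈ X.cubes, v ∈ c ∧ a ∈ c ∧ b ∈ c) :
    ∃ c ∈ X.cubes, v ∈ c ∧ s ⊆ c := by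
  classical
  rcases s.eq_empty_or_nonempty with rfl | ⟨a₀, ha₀⟩
  · exact ⟨{v}, X.singleton_mem v, rfl, Set.empty_subset _⟩
  have hfin : {w : X.skeleton.neighborSet v | (w : V) ∈ s}.Finite :=
    hs.preimage Subtype.val_injective.injOn
  have hmem : hfin.toFinset ∈ (X.link v).faces := by
    refine hX v _ ⟨⟨a₀, hadj a₀ ha₀⟩, by simpa using ha₀⟩ ?_
    intro a ha b hb hab
    simp only [Set.Finite.mem_toFinset, Set.mem_ofPred_eq] at ha hb
    obtain ⟨c, hc, hv, hac, hbc⟩ := hpair a ha b hb (fun h => hab (Subtype.ext h))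
    refine ⟨{a, b}, ⟨by simp, c, hc, hv, ?_⟩, by simp⟩
    simp [hac, hbc]
  obtain ⟨-, c, hc, hv, hcs⟩ := hmem
  exact ⟨c, hc, hv, fun a ha => hcs ⟨a, hadj a ha⟩ (by simpa using ha)⟩

/-- The `3`-cube condition: three squares around a vertex are completed by three further squares. -/
theorem exists_three_cube (hX : ∀ v, IsFlagComplex (X.link v)) {v a b c p q r : V}
    (hab : X.IsSquare v a p b) (hbc : X.IsSquare v b q c) (hac : X.IsSquare v a r c) :
    ∃ z, X.IsSquare a p z r ∧ X.IsSquare b p z q ∧ X.IsSquare c q z r := by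
  obtain ⟨k, hk, hv, hs⟩ := exists_cube_of_flag hX (v := v) (s := {a, b, c}) (by simp)
    (by rintro x (rfl | rfl | rfl); exacts [hab.1, hbc.1, hbc.2.2.2.1])
    (by
      have h1 := hab.2.2.2.2.2.2
      have h2 := hbc.2.2.2.2.2.2
      have h3 := hac.2.2.2.2.2.2
      rintro x (rfl | rfl | rfl) y (rfl | rfl | rfl) hxy
      all_goals first
        | exact absurd rfl hxy
        | (refine ⟨_, h1, ?_, ?_, ?_⟩ <;> simp; done)
        | (refine ⟨_, h2, ?_, ?_, ?_⟩ <;> simp; done)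
        | (refine ⟨_, h3, ?_, ?_, ?_⟩ <;> simp))
  obtain ⟨ψ⟩ := nonempty_basedChart hk hv
  obtain ⟨i, hi⟩ := ψ.exists_eq_singleton (hs (by simp)) hab.1
  obtain ⟨j, hj⟩ := ψ.exists_eq_singleton (hs (by simp)) hbc.1
  obtain ⟨l, hl⟩ := ψ.exists_eq_singleton (hs (by simp)) hbc.2.2.2.1
  have hij : i ≠ j := by rintro rfl; exact hab.2.2.2.2.2.1 (hi.symm.trans hj)
  have hjl : j ≠ l := by rintro rfl; exact hbc.2.2.2.2.2.1 (hj.symm.trans hl)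
  have hil : i ≠ l := by rintro rfl; exact hac.2.2.2.2.2.1 (hi.symm.trans hl)
  have key : ∀ {x y m : V} {i j : Fin ψ.n}, i ≠ j → ψ.toFun {i} = x → ψ.toFun {j} = y →
      X.IsSquare v x m y → m = ψ.toFun {i, j} := by
    rintro x y m i j hij rfl rfl h
    have h' := ψ.isSquare (s := ∅) hij (by simp) (by simp)
    rw [ψ.base] at h'
    exact h.symm.rotate.rotate.rotate.unique h'.symm.rotate.rotate.rotate
  have hp := key hij hi hj hab
  have hq := key hjl hj hl hbc
  have hr := key hil hi hl hac
  refine ⟨ψ.toFun {i, j, l}, ?_, ?_, ?_⟩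
  · have := ψ.isSquare (s := {i}) hjl (by simp [hij.symm]) (by simp [hil.symm])
    rw [hi, Finset.pair_comm j i, Finset.pair_comm l i, ← hp, ← hr] at this
    convert this using 2
    ext; simp; tauto
  · have := ψ.isSquare (s := {j}) hil (by simp [hij]) (by simp [hjl.symm])
    rw [hj, Finset.pair_comm l j, ← hp, ← hq] at this
    convert this using 2
  · have := ψ.isSquare (s := {l}) hij.symm (by simp [hjl]) (by simp [hil])
    rw [hl, ← hq, ← hr] at this
    convert this using 2
    ext; simp; tauto

end CubeComplex

namespace CubeComplex

variable {V : Type u} {X : CubeComplex V}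

/-! ### Pushing paths across squares -/

/-- The equivalence relation on edge paths, given by their vertex sequences, that is generated by
pushing a path across a square. -/
inductive SquareEquiv (X : CubeComplex V) : List V → List V → Prop
  | refl (l : List V) : SquareEquiv X l l
  | symm {l l' : List V} : SquareEquiv X l l' → SquareEquiv X l' l
  | trans {l l' l'' : List V} : SquareEquiv X l l' → SquareEquiv X l' l'' → SquareEquiv X l l''
  | cons (a : V) {l l' : List V} : SquareEquiv X l l' → SquareEquiv X (a :: l) (a :: l')
  | square {a b c d : V} (h : X.IsSquare a b c d) (l : List V) :
      SquareEquiv X (a :: b :: c :: l) (a :: d :: c :: l)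

namespace SquareEquiv

theorem length_eq {l l' : List V} (h : X.SquareEquiv l l') : l.length = l'.length := by
  induction h with
  | refl => rfl
  | symm _ ih => exact ih.symm
  | trans _ _ ih ih' => exact ih.trans ih'
  | cons a _ ih => simp [ih]
  | square => rfl

theorem head?_eq {l l' : List V} (h : X.SquareEquiv l l') : l.head? = l'.head? := by
  induction h with
  | refl => rfl
  | symm _ ih => exact ih.symm
  | trans _ _ ih ih' => exact ih.trans ih'
  | cons a _ ih => rfl
  | square => rfl

theorem exists_eq_cons {a : V} {l l' : List V} (h : X.SquareEquiv (a :: l) l') :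
    ∃ m, l' = a :: m := by
  have h1 := h.head?_eq
  rcases l' with _ | ⟨b, m⟩
  · simp at h1
  · simp at h1
    exact ⟨m, by rw [h1]⟩

/-- The diamond property of square equivalence: if two equivalent paths start with different edges,
then these edges span a square and both paths can be pushed to pass through its far corner. -/
theorem diamond_aux (hX : ∀ v, IsFlagComplex (X.link v)) (n : ℕ) :
    ∀ L L' : List V, X.SquareEquiv L L' → L.length = n → ∀ v u p u' p', L = v :: u :: p →
      L' = v :: u' :: p' → (u = u' ∧ X.SquareEquiv (u :: p) (u' :: p')) ∨
        ∃ t r, X.IsSquare v u t u' ∧ X.SquareEquiv (u :: p) (u :: t :: r) ∧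
          X.SquareEquiv (u' :: p') (u' :: t :: r) := by
  induction n using Nat.strong_induction_on with
  | _ n ihn =>
    intro L L' h
    induction h with
    | refl l =>
      rintro - v u p u' p' rfl h'
      simp only [List.cons.injEq, true_and] at h'
      obtain ⟨rfl, rfl⟩ := h'
      exact Or.inl ⟨rfl, .refl _⟩
    | symm h ih =>
      intro hn v u p u' p' hL hL'
      rcases ih (h.length_eq.trans hn) v u' p' u p hL' hL with ⟨rfl, h1⟩ | ⟨t, r, h1, h2, h3⟩
      · exact Or.inl ⟨rfl, h1.symm⟩
      · exact Or.inr ⟨t, r, h1.symm, h3, h2⟩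
    | @trans L M L' h h' ih ih' =>
      rintro hn v u p u' p' rfl rfl
      obtain ⟨m, rfl⟩ := h.exists_eq_cons
      obtain ⟨w, m, rfl⟩ : ∃ w m', m = w :: m' := by
        have := h.length_eq
        rcases m with _ | ⟨w, m⟩
        · simp at this
        · exact ⟨w, m, rfl⟩
      have hn' : (v :: w :: m).length = n := h.length_eq.symm.trans hn
      rcases ih hn v u p w m rfl rfl with ⟨rfl, h1⟩ | ⟨t, r, h1, h2, h3⟩
      · rcases ih' hn' v u m u' p' rfl rfl with ⟨rfl, h4⟩ | ⟨t', r', h4, h5, h6⟩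
        · exact Or.inl ⟨rfl, h1.trans h4⟩
        · exact Or.inr ⟨t', r', h4, h1.trans h5, h6⟩
      · rcases ih' hn' v w m u' p' rfl rfl with ⟨rfl, h4⟩ | ⟨t', r', h4, h5, h6⟩
        · exact Or.inr ⟨t, r, h1, h2, h4.symm.trans h3⟩
        -- Both halves of the chain change the first edge. Their tails from the middle vertex `w`
        -- are equivalent and shorter, so the outer induction compares them.
        · have h7 := h3.symm.trans h5
          have hlt : (w :: t :: r).length < n := by
            have := h3.length_eq
            rw [← this, ← hn']
            simp
          rcases ihn _ hlt _ _ h7 rfl w t r t' r' rfl rfl with ⟨rfl, h8⟩ | ⟨s, q, h8, h9, h10⟩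
          · obtain rfl := h1.symm.unique h4
            exact Or.inl ⟨rfl, h2.trans ((h8.cons u).trans h6.symm)⟩
          -- The three squares meet at `w`, whose neighbours in them are `v`, `t` and `t'`; `z` is
          -- the corner opposite to `w`.
          · obtain ⟨z, hz1, hz2, hz3⟩ := exists_three_cube hX h1.rotate.rotate.rotate h8
              h4.symm.rotate.rotate.rotate
            exact Or.inr ⟨z, s :: q, hz1,
              h2.trans ((h9.cons u).trans (.square hz2.rotate.symm q)),
              h6.trans ((h10.cons u').trans (.square hz3.rotate.rotate.rotate q))⟩
    | cons a h ih =>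
      rintro hn v u p u' p' h1 h2
      simp only [List.cons.injEq] at h1 h2
      obtain ⟨rfl, rfl⟩ := h1
      obtain ⟨-, rfl⟩ := h2
      exact Or.inl ⟨by simpa using h.head?_eq, h⟩
    | @square a b c d h l =>
      rintro hn v u p u' p' h1 h2
      simp only [List.cons.injEq] at h1 h2
      obtain ⟨rfl, rfl, rfl⟩ := h1
      obtain ⟨-, rfl, rfl⟩ := h2
      exact Or.inr ⟨c, l, h, .refl _, .refl _⟩

theorem diamond (hX : ∀ v, IsFlagComplex (X.link v)) {v u u' : V} {p p' : List V}
    (h : X.SquareEquiv (v :: u :: p) (v :: u' :: p')) (hne : u ≠ u') :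
    ∃ t r, X.IsSquare v u t u' ∧ X.SquareEquiv (u :: p) (u :: t :: r) ∧
      X.SquareEquiv (u' :: p') (u' :: t :: r) := by
  rcases diamond_aux hX _ _ _ h rfl _ _ _ _ _ rfl rfl with ⟨h1, -⟩ | h1
  · exact absurd h1 hne
  · exact h1

theorem cancel (hX : ∀ v, IsFlagComplex (X.link v)) {v u : V} {p p' : List V}
    (h : X.SquareEquiv (v :: u :: p) (v :: u :: p')) : X.SquareEquiv (u :: p) (u :: p') := by
  rcases diamond_aux hX _ _ _ h rfl _ _ _ _ _ rfl rfl with ⟨-, h1⟩ | ⟨t, r, h1, -⟩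
  · exact h1
  · exact absurd rfl h1.2.2.2.2.2.1

end SquareEquiv

/-! ### Reduced paths and reduced forms -/

/-- A path is reduced if no backtrack can be produced by pushing it across squares. -/
def Reduced (X : CubeComplex V) : List V → Prop
  | [] => True
  | [_] => True
  | v :: u :: p => Reduced X (u :: p) ∧ ∀ q, ¬ X.SquareEquiv (u :: p) (u :: v :: q)

theorem Reduced.tail {v : V} {l : List V} (h : X.Reduced (v :: l)) : X.Reduced l := by
  cases l with
  | nil => trivial
  | cons u p => exact h.1

/-- Only a square at the start of the path is delicate. A backtrack created behind the pushed corner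
would, by the diamond property, force one that was already in the original path. -/
theorem SquareEquiv.reduced_iff (hX : ∀ v, IsFlagComplex (X.link v)) {l l' : List V}
    (h : X.SquareEquiv l l') : X.Reduced l ↔ X.Reduced l' := by
  have square : ∀ {a b c d : V}, X.IsSquare a b c d → ∀ l, X.Reduced (a :: b :: c :: l) →
      X.Reduced (a :: d :: c :: l) := by
    intro a b c d h l hl
    refine ⟨⟨hl.1.1, fun q hq => ?_⟩, fun q hq => ?_⟩
    · exact hl.2 (d :: q) ((hq.cons b).trans (.square h.rotate q))
    · obtain ⟨t, r, h1, h2, -⟩ := hq.diamond hX h.2.2.2.2.1.symm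
      obtain rfl := h1.rotate.rotate.rotate.unique h.symm
      exact hl.1.2 r h2
  induction h with
  | refl => rfl
  | symm _ ih => exact ih.symm
  | trans _ _ ih ih' => exact ih.trans ih'
  | @cons a l l' h ih =>
    rcases l with _ | ⟨u, p⟩
    · have := h.length_eq
      obtain rfl := List.eq_nil_of_length_eq_zero this.symm
      rfl
    · obtain ⟨p', rfl⟩ := h.exists_eq_cons
      exact and_congr ih (forall_congr' fun q =>
        not_congr ⟨fun hq => h.symm.trans hq, fun hq => h.trans hq⟩)
  | square h l => exact ⟨square h l, square h.symm l⟩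

open Classical in
/-- Prolong a reduced path by an edge to `w`, and cancel if possible. -/
noncomputable def extend (X : CubeComplex V) (w : V) : List V → List V
  | [] => [w]
  | v :: p => if h : ∃ q, X.SquareEquiv (v :: p) (v :: w :: q) then w :: h.choose else w :: v :: p

theorem extend_cases (X : CubeComplex V) (w v : V) (p : List V) :
    (∃ q, X.SquareEquiv (v :: p) (v :: w :: q) ∧ X.extend w (v :: p) = w :: q) ∨
      ((∀ q, ¬ X.SquareEquiv (v :: p) (v :: w :: q)) ∧ X.extend w (v :: p) = w :: v :: p) := by
  by_cases h : ∃ q, X.SquareEquiv (v :: p) (v :: w :: q)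
  · exact Or.inl ⟨h.choose, h.choose_spec, by simp only [extend]; rw [dif_pos h]⟩
  · exact Or.inr ⟨not_exists.1 h, by simp only [extend]; rw [dif_neg h]⟩

theorem exists_extend_eq_cons (X : CubeComplex V) (w v : V) (p : List V) :
    ∃ q, X.extend w (v :: p) = w :: q := by
  rcases X.extend_cases w v p with ⟨q, -, h⟩ | ⟨-, h⟩
  exacts [⟨_, h⟩, ⟨_, h⟩]

theorem extend_of_squareEquiv (hX : ∀ v, IsFlagComplex (X.link v)) {w v : V} {p q : List V}
    (h : X.SquareEquiv (v :: p) (v :: w :: q)) :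
    X.SquareEquiv (X.extend w (v :: p)) (w :: q) := by
  rcases X.extend_cases w v p with ⟨q', h', e⟩ | ⟨h', -⟩
  · rw [e]
    exact (h'.symm.trans h).cancel hX
  · exact absurd h (h' q)

theorem extend_of_not {w v : V} {p : List V}
    (h : ∀ q, ¬ X.SquareEquiv (v :: p) (v :: w :: q)) : X.extend w (v :: p) = w :: v :: p := by
  rcases X.extend_cases w v p with ⟨q', h', e⟩ | ⟨-, e⟩
  · exact absurd h' (h q')
  · exact e

theorem Reduced.extend (hX : ∀ v, IsFlagComplex (X.link v)) {w v : V} {p : List V}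
    (h : X.Reduced (v :: p)) : X.Reduced (X.extend w (v :: p)) := by
  rcases X.extend_cases w v p with ⟨q, h', e⟩ | ⟨h', e⟩
  · rw [e]
    exact ((h'.reduced_iff hX).1 h).tail
  · rw [e]
    exact ⟨h, h'⟩

theorem SquareEquiv.extend (hX : ∀ v, IsFlagComplex (X.link v)) {w v : V} {p p' : List V}
    (h : X.SquareEquiv (v :: p) (v :: p')) :
    X.SquareEquiv (X.extend w (v :: p)) (X.extend w (v :: p')) := by
  rcases X.extend_cases w v p with ⟨q, h', e⟩ | ⟨h', e⟩
  · rw [e]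
    exact (extend_of_squareEquiv hX (h.symm.trans h')).symm
  · rw [e, extend_of_not fun q hq => h' q (h.trans hq)]
    exact h.cons w

/-- This is compatibility of `extend` with the backtrack relation of `Homotopic`: a cancelled edge
is put back, or a new one cancels at once. Reducedness excludes a second cancellation in the former
case. -/
theorem extend_extend (hX : ∀ v, IsFlagComplex (X.link v)) {w v : V} {p : List V}
    (hred : X.Reduced (v :: p)) :
    X.SquareEquiv (X.extend v (X.extend w (v :: p))) (v :: p) := by
  rcases X.extend_cases w v p with ⟨q, h', e⟩ | ⟨h', e⟩
  · rw [e, extend_of_not]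
    · exact h'.symm
    · exact ((h'.reduced_iff hX).1 hred).2
  · rw [e]
    exact extend_of_squareEquiv hX (.refl _)

/-- This is compatibility of `extend` with the square relation of `Homotopic`. The cases record
which of the two edges at `a` cancel; when both do, the diamond property makes the second edges
cancel as well. -/
theorem extend_square (hX : ∀ v, IsFlagComplex (X.link v)) {a b c d : V} {p : List V}
    (h : X.IsSquare a b c d) :
    X.SquareEquiv (X.extend c (X.extend b (a :: p))) (X.extend c (X.extend d (a :: p))) := by
  have cons : ∀ {b : V} {l : List V}, X.SquareEquiv (X.extend b (a :: p)) (b :: l) →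
      X.SquareEquiv (X.extend c (X.extend b (a :: p))) (X.extend c (b :: l)) := by
    intro b l hl
    obtain ⟨q, hq⟩ := X.exists_extend_eq_cons b a p
    rw [hq] at hl ⊢
    exact hl.extend hX
  have mixed : ∀ {b d : V}, X.IsSquare a b c d → ∀ q, X.SquareEquiv (a :: p) (a :: b :: q) →
      (∀ q, ¬ X.SquareEquiv (a :: p) (a :: d :: q)) →
      X.SquareEquiv (X.extend c (X.extend b (a :: p))) (X.extend c (X.extend d (a :: p))) := by
    intro b d h q hq hd
    refine (cons (extend_of_squareEquiv hX hq)).trans ?_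
    rw [extend_of_not hd, extend_of_not]
    · refine (extend_of_squareEquiv hX (q := b :: q) ?_).symm
      exact (hq.cons d).trans (.square h.rotate.rotate.rotate q)
    · intro r hr
      exact hd (c :: r) (hq.trans ((hr.cons a).trans (.square h r)))
  by_cases hb : ∃ q, X.SquareEquiv (a :: p) (a :: b :: q) <;>
    by_cases hd : ∃ q, X.SquareEquiv (a :: p) (a :: d :: q)
  · obtain ⟨q, hq⟩ := hb
    obtain ⟨q', hq'⟩ := hd
    obtain ⟨t, r, h1, h2, h3⟩ := (hq.symm.trans hq').diamond hX h.2.2.2.2.2.1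
    obtain rfl := h1.symm.rotate.rotate.rotate.unique h.symm.rotate.rotate.rotate
    exact ((cons (extend_of_squareEquiv hX hq)).trans (extend_of_squareEquiv hX h2)).trans
      ((cons (extend_of_squareEquiv hX hq')).trans (extend_of_squareEquiv hX h3)).symm
  · obtain ⟨q, hq⟩ := hb
    exact mixed h q hq (not_exists.1 hd)
  · obtain ⟨q, hq⟩ := hd
    exact (mixed h.symm q hq (not_exists.1 hb)).symm
  · have key : ∀ {b d : V}, X.IsSquare a b c d → (∀ q, ¬ X.SquareEquiv (a :: p) (a :: b :: q)) →
        (∀ q, ¬ X.SquareEquiv (a :: p) (a :: d :: q)) →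
        X.extend c (X.extend b (a :: p)) = c :: b :: a :: p := by
      intro b d h hb hd
      rw [extend_of_not hb, extend_of_not]
      intro q hq
      obtain ⟨t, r, h1, h2, -⟩ := hq.diamond hX h.2.2.2.2.1
      obtain rfl := h1.symm.rotate.rotate.rotate.unique h
      exact hd r h2
    rw [key h (not_exists.1 hb) (not_exists.1 hd), key h.symm (not_exists.1 hd) (not_exists.1 hb)]
    exact .square h.symm.rotate.rotate p

/-- The reduced form of an edge path. -/
noncomputable def reducedForm : ∀ {a b : V}, X.skeleton.Walk a b → List V
  | a, _, .nil => [a]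
  | a, _, .cons _ p => X.extend a (reducedForm p)

theorem exists_reducedForm_eq_cons {a b : V} (p : X.skeleton.Walk a b) :
    ∃ l, reducedForm p = a :: l := by
  induction p with
  | nil => exact ⟨_, rfl⟩
  | @cons a b c h p ih =>
    obtain ⟨l, hl⟩ := ih
    simp only [reducedForm, hl]
    exact X.exists_extend_eq_cons a b l

theorem reduced_reducedForm (hX : ∀ v, IsFlagComplex (X.link v)) {a b : V}
    (p : X.skeleton.Walk a b) : X.Reduced (reducedForm p) := by
  induction p with
  | nil => trivial
  | @cons a b c h p ih =>
    obtain ⟨l, hl⟩ := exists_reducedForm_eq_cons p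
    simp only [reducedForm]
    rw [hl] at ih ⊢
    exact ih.extend hX

theorem Homotopic.reducedForm (hX : ∀ v, IsFlagComplex (X.link v)) {a b : V}
    {p q : X.skeleton.Walk a b} (h : X.Homotopic p q) :
    X.SquareEquiv (reducedForm p) (reducedForm q) := by
  induction h with
  | refl => exact .refl _
  | symm _ ih => exact ih.symm
  | trans _ _ ih ih' => exact ih.trans ih'
  | @cons a b c h p q hpq ih =>
    obtain ⟨l, hl⟩ := exists_reducedForm_eq_cons p
    obtain ⟨l', hl'⟩ := exists_reducedForm_eq_cons q
    simp only [CubeComplex.reducedForm]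
    rw [hl, hl'] at ih ⊢
    exact ih.extend hX
  | @backtrack a b c h p =>
    obtain ⟨l, hl⟩ := exists_reducedForm_eq_cons p
    have hr := reduced_reducedForm hX p
    simp only [CubeComplex.reducedForm]
    rw [hl] at hr ⊢
    exact extend_extend hX hr
  | @square a b c d e h p =>
    obtain ⟨l, hl⟩ := exists_reducedForm_eq_cons p
    simp only [CubeComplex.reducedForm]
    rw [hl]
    exact extend_square hX h.symm.rotate.rotate

theorem Reduced.squareEquiv_reducedForm {a b : V} {p : X.skeleton.Walk a b}
    (h : X.Reduced p.support) : X.SquareEquiv (reducedForm p) p.support := by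
  induction p with
  | nil => exact .refl _
  | @cons a b c e p ih =>
    have ih' := ih h.tail
    obtain ⟨l, hl⟩ := exists_reducedForm_eq_cons p
    simp only [CubeComplex.reducedForm, SimpleGraph.Walk.support_cons]
    rw [SimpleGraph.Walk.support_cons] at h
    rw [hl] at ih' ⊢
    obtain ⟨m, hm⟩ := ih'.exists_eq_cons
    rw [hm] at h ih' ⊢
    rw [extend_of_not fun q hq => h.2 q (ih'.symm.trans hq)]
    exact ih'.cons a

theorem Homotopic.append_right {a b c : V} {p q : X.skeleton.Walk a b} (h : X.Homotopic p q)
    (r : X.skeleton.Walk b c) : X.Homotopic (p.append r) (q.append r) := by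
  induction h with
  | refl => exact .refl _
  | symm _ ih => exact (ih r).symm
  | trans _ _ ih ih' => exact (ih r).trans (ih' r)
  | cons h _ ih => exact (ih r).cons h
  | backtrack h p => exact .backtrack h _
  | square h p => exact .square h _

theorem Homotopic.append_left {a b c : V} (r : X.skeleton.Walk a b) {p q : X.skeleton.Walk b c}
    (h : X.Homotopic p q) : X.Homotopic (r.append p) (r.append q) := by
  induction r with
  | nil => exact h
  | cons e r ih => exact (ih h).cons e

theorem IsSimplyConnected.homotopic (hX : X.IsSimplyConnected) {a b : V}
    (p q : X.skeleton.Walk a b) : X.Homotopic p q := by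
  have h1 := (hX.2 b (q.reverse.append q)).append_left p
  have h2 := (hX.2 a (p.append q.reverse)).append_right q
  rw [SimpleGraph.Walk.append_nil] at h1
  rw [← SimpleGraph.Walk.append_assoc, SimpleGraph.Walk.nil_append] at h2
  exact h1.symm.trans h2

/-- In a CAT(0) cube complex reduced paths are determined by their end points up to pushing across
squares. -/
theorem IsCAT0.squareEquiv (hX : X.IsCAT0) {a b : V} {p q : X.skeleton.Walk a b}
    (hp : X.Reduced p.support) (hq : X.Reduced q.support) :
    X.SquareEquiv p.support q.support :=
  (hp.squareEquiv_reducedForm).symm.trans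
    (((hX.1.homotopic p q).reducedForm hX.2).trans hq.squareEquiv_reducedForm)

theorem eq_of_support_eq_cons {a b x : V} {l : List V} {p : X.skeleton.Walk a b}
    (h : p.support = x :: l) : a = x := by
  rw [← SimpleGraph.Walk.cons_tail_support] at h
  exact (List.cons.inj h).1

/-- The two sides of a square are both edge paths, so a move on vertex lists lifts to walks. This
turns list equivalences back into distance estimates. -/
theorem SquareEquiv.exists_walk_iff {l l' : List V} (h : X.SquareEquiv l l') (a b : V) :
    (∃ p : X.skeleton.Walk a b, p.support = l) ↔ ∃ p : X.skeleton.Walk a b, p.support = l' := by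
  have square : ∀ {x y z w : V}, X.IsSquare x y z w → ∀ l (a : V),
      (∃ p : X.skeleton.Walk a b, p.support = x :: y :: z :: l) →
      ∃ p : X.skeleton.Walk a b, p.support = x :: w :: z :: l := by
    rintro x y z w h l a ⟨p, hp⟩
    cases p with
    | nil => simp at hp
    | cons e p =>
      cases p with
      | nil => simp at hp
      | cons e' p =>
        simp only [SimpleGraph.Walk.support_cons, List.cons.injEq] at hp
        obtain ⟨rfl, rfl, hp⟩ := hp
        obtain rfl := eq_of_support_eq_cons hp
        exact ⟨.cons h.2.2.2.1 (.cons h.2.2.1 p), by simp [hp]⟩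
  induction h generalizing a with
  | refl => rfl
  | symm _ ih => exact (ih a).symm
  | trans _ _ ih ih' => exact (ih a).trans (ih' a)
  | @cons x l l' h ih =>
    have key : ∀ {l l' : List V}, X.SquareEquiv l l' →
        (∀ a, (∃ p : X.skeleton.Walk a b, p.support = l) →
          ∃ p : X.skeleton.Walk a b, p.support = l') →
        (∃ p : X.skeleton.Walk a b, p.support = x :: l) →
          ∃ p : X.skeleton.Walk a b, p.support = x :: l' := by
      rintro l l' h ih ⟨p, hp⟩
      cases p with
      | nil =>
        simp only [SimpleGraph.Walk.support_nil, List.cons.injEq] at hp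
        obtain ⟨rfl, rfl⟩ := hp
        obtain rfl := List.eq_nil_of_length_eq_zero h.length_eq.symm
        exact ⟨.nil, rfl⟩
      | cons e p =>
        simp only [SimpleGraph.Walk.support_cons, List.cons.injEq] at hp
        obtain ⟨rfl, hp⟩ := hp
        obtain ⟨p', hp'⟩ := ih _ ⟨p, hp⟩
        exact ⟨.cons e p', by simp [hp']⟩
    exact ⟨key h fun a => (ih a).1, key h.symm fun a => (ih a).2⟩
  | square h l => exact ⟨square h l a, square h.symm l a⟩

theorem SquareEquiv.exists_walk {u w b : V} {p : X.skeleton.Walk u b} {l : List V}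
    (h : X.SquareEquiv p.support (u :: w :: l)) :
    ∃ r : X.skeleton.Walk w b, r.length + 1 = p.length := by
  obtain ⟨r, hr⟩ := (h.exists_walk_iff u b).1 ⟨p, rfl⟩
  have hlen := h.length_eq
  cases r with
  | nil => simp at hr
  | cons e r =>
    simp only [SimpleGraph.Walk.support_cons, List.cons.injEq, true_and] at hr
    obtain rfl := eq_of_support_eq_cons hr
    refine ⟨r, ?_⟩
    rw [← hr] at hlen
    simpa using hlen.symm

theorem exists_walk_of_not_reduced_cons {a b c : V} {e : X.skeleton.Adj a b}
    {p : X.skeleton.Walk b c} (hp : X.Reduced p.support)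
    (h : ¬ X.Reduced (SimpleGraph.Walk.cons e p).support) :
    ∃ r : X.skeleton.Walk a c, r.length + 1 = p.length := by
  have h' : ∃ q, X.SquareEquiv p.support (b :: a :: q) := by
    rw [SimpleGraph.Walk.support_cons, ← SimpleGraph.Walk.cons_tail_support] at h
    rw [← SimpleGraph.Walk.cons_tail_support] at hp ⊢
    by_contra! hcon
    exact h ⟨hp, hcon⟩
  obtain ⟨q, hq⟩ := h'
  exact hq.exists_walk

theorem exists_shorter_walk {a b : V} (p : X.skeleton.Walk a b) (h : ¬ X.Reduced p.support) :
    ∃ q : X.skeleton.Walk a b, q.length < p.length := by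
  induction p with
  | nil => exact absurd trivial h
  | @cons a b c e p ih =>
    by_cases hp : X.Reduced p.support
    · obtain ⟨r, hr⟩ := exists_walk_of_not_reduced_cons hp h
      exact ⟨r, by rw [SimpleGraph.Walk.length_cons]; omega⟩
    · obtain ⟨q, hq⟩ := ih hp
      exact ⟨.cons e q, by simpa using hq⟩

theorem reduced_of_length_eq_dist {a b : V} {p : X.skeleton.Walk a b}
    (h : p.length = X.skeleton.dist a b) : X.Reduced p.support := by
  by_contra hcon
  obtain ⟨q, hq⟩ := exists_shorter_walk p hcon
  have := SimpleGraph.dist_le q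
  omega

/-! ### Metric consequences: bipartiteness and quadrangles -/

/-- The `1`-skeleton of a CAT(0) cube complex is bipartite. -/
theorem IsCAT0.dist_ne (hX : X.IsCAT0) {u v : V} (h : X.skeleton.Adj v u) (o : V) :
    X.skeleton.dist v o ≠ X.skeleton.dist u o := by
  intro heq
  obtain ⟨p, hp⟩ := hX.1.1.exists_walk_length_eq_dist u o
  obtain ⟨q, hq⟩ := hX.1.1.exists_walk_length_eq_dist v o
  -- If prepending `v` keeps the path reduced, it is equivalent to `q`, which is one edge shorter;
  -- otherwise cancellation gives a path from `v` that is too short.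
  by_cases hr : X.Reduced (SimpleGraph.Walk.cons h p).support
  · have := (hX.squareEquiv hr (reduced_of_length_eq_dist hq)).length_eq
    simp only [SimpleGraph.Walk.length_support, SimpleGraph.Walk.length_cons] at this
    omega
  · obtain ⟨r, hr⟩ := exists_walk_of_not_reduced_cons (reduced_of_length_eq_dist hp) hr
    have := SimpleGraph.dist_le r
    omega

/-- The quadrangle condition. -/
theorem IsCAT0.quadrangle (hX : X.IsCAT0) {u u' v o : V} (h : X.skeleton.Adj v u)
    (h' : X.skeleton.Adj v u') (hne : u ≠ u')
    (hd : X.skeleton.dist u o + 1 = X.skeleton.dist v o)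
    (hd' : X.skeleton.dist u' o + 1 = X.skeleton.dist v o) :
    ∃ t, X.IsSquare v u t u' ∧ X.skeleton.dist t o + 1 = X.skeleton.dist u o := by
  obtain ⟨p, hp⟩ := hX.1.1.exists_walk_length_eq_dist u o
  obtain ⟨q, hq⟩ := hX.1.1.exists_walk_length_eq_dist u' o
  have hs := hX.squareEquiv (p := .cons h p) (q := .cons h' q)
    (reduced_of_length_eq_dist (by rw [SimpleGraph.Walk.length_cons, hp, hd]))
    (reduced_of_length_eq_dist (by rw [SimpleGraph.Walk.length_cons, hq, hd']))
  rw [SimpleGraph.Walk.support_cons, SimpleGraph.Walk.support_cons,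
    ← SimpleGraph.Walk.cons_tail_support, ← q.cons_tail_support] at hs
  obtain ⟨t, l, h1, h2, -⟩ := hs.diamond hX.2 hne
  refine ⟨t, h1, ?_⟩
  rw [SimpleGraph.Walk.cons_tail_support] at h2
  obtain ⟨r, hr⟩ := h2.exists_walk
  have := SimpleGraph.dist_le r
  have := hX.1.1.dist_triangle (u := u) (v := t) (w := o)
  have := SimpleGraph.dist_eq_one_iff_adj.2 h1.2.1
  omega

end CubeComplex

namespace CubeComplex

variable {V : Type u} {X : CubeComplex V}

namespace IsCAT0

theorem dist_adj (hX : X.IsCAT0) {u v : V} (h : X.skeleton.Adj u v) (o : V) :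
    X.skeleton.dist u o = X.skeleton.dist v o + 1 ∨
      X.skeleton.dist v o = X.skeleton.dist u o + 1 := by
  have h1 := hX.dist_ne h o
  have h2 := hX.1.1.dist_triangle (u := u) (v := v) (w := o)
  have h3 := hX.1.1.dist_triangle (u := v) (v := u) (w := o)
  rw [SimpleGraph.dist_eq_one_iff_adj.2 h] at h2
  rw [SimpleGraph.dist_eq_one_iff_adj.2 h.symm] at h3
  omega

theorem exists_adj_dist (hX : X.IsCAT0) {u v : V} (h : u ≠ v) :
    ∃ w, X.skeleton.Adj u w ∧ X.skeleton.dist w v + 1 = X.skeleton.dist u v := by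
  obtain ⟨p, hp⟩ := hX.1.1.exists_walk_length_eq_dist u v
  cases p with
  | nil => exact absurd rfl h
  | @cons _ w _ e p =>
    refine ⟨w, e, ?_⟩
    have h1 := SimpleGraph.dist_le p
    rw [SimpleGraph.Walk.length_cons] at hp
    have h2 := hX.dist_adj e v
    omega

/-- A four-cycle is the boundary of a square. -/
theorem isSquare (hX : X.IsCAT0) {a b c d : V} (hab : X.skeleton.Adj a b)
    (hbc : X.skeleton.Adj b c) (hdc : X.skeleton.Adj d c) (had : X.skeleton.Adj a d)
    (hac : a ≠ c) (hbd : b ≠ d) : X.IsSquare a b c d := by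
  have h1 := SimpleGraph.dist_eq_one_iff_adj.2 hbc
  have h2 := SimpleGraph.dist_eq_one_iff_adj.2 hdc
  have h3 := hX.dist_adj hab c
  have h4 := hX.1.1.pos_dist_of_ne hac
  obtain ⟨t, ht, ht'⟩ := hX.quadrangle (o := c) hab had hbd (by omega) (by omega)
  have : t = c := hX.1.1.dist_eq_zero_iff.1 (by omega)
  rwa [← this]

/-- A set that contains, with any two of its vertices, the first edges of the geodesics between
them, is convex. -/
theorem mem_of_forall_adj (hX : X.IsCAT0) {S : Set V}
    (hS : ∀ x ∈ S, ∀ y ∈ S, ∀ z, X.skeleton.Adj x z →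
      X.skeleton.dist z y + 1 = X.skeleton.dist x y → z ∈ S)
    {x y z : V} (hx : x ∈ S) (hy : y ∈ S)
    (h : X.skeleton.dist x z + X.skeleton.dist z y = X.skeleton.dist x y) : z ∈ S := by
  induction hn : X.skeleton.dist x z generalizing x with
  | zero => rwa [← hX.1.1.dist_eq_zero_iff.1 hn]
  | succ n ih =>
    have hne : x ≠ z := by
      rintro rfl
      simp at hn
    obtain ⟨w, hw, hw'⟩ := hX.exists_adj_dist hne
    have h1 := hX.dist_adj hw y
    have h2 := hX.1.1.dist_triangle (u := w) (v := z) (w := y)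
    exact ih (hS x hx y hy w hw (by omega)) (by omega) (by omega)

end IsCAT0

/-! ### Halfspaces and hyperplanes -/

/-- The vertices that are closer to `a` than to `b`: for adjacent `a`, `b` a halfspace. -/
def halfspace (X : CubeComplex V) (a b : V) : Set V :=
  {x | X.skeleton.dist x a < X.skeleton.dist x b}

theorem left_mem_halfspace {a b : V} (h : X.skeleton.Adj a b) : a ∈ X.halfspace a b := by
  have := SimpleGraph.dist_eq_one_iff_adj.2 h
  simp [halfspace, this]

theorem right_notMem_halfspace (a b : V) : b ∉ X.halfspace a b := by
  simp [halfspace]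

namespace IsCAT0

theorem dist_adj' (hX : X.IsCAT0) {u v : V} (h : X.skeleton.Adj u v) (o : V) :
    X.skeleton.dist o u = X.skeleton.dist o v + 1 ∨
      X.skeleton.dist o v = X.skeleton.dist o u + 1 := by
  rw [X.skeleton.dist_comm (u := o), X.skeleton.dist_comm (u := o)]
  exact hX.dist_adj h o

theorem notMem_halfspace (hX : X.IsCAT0) {a b : V} (h : X.skeleton.Adj a b) {x : V} :
    x ∉ X.halfspace a b ↔ x ∈ X.halfspace b a := by
  have := hX.dist_adj' h x
  simp only [halfspace, Set.mem_ofPred_eq]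
  omega

/-- Otherwise `a` and `c` are both nearer to `x` than `b`. The quadrangle condition then makes the
fourth corner `d` nearer still, although `d` is farther from `x` than `c`. -/
theorem mem_halfspace_of_isSquare (hX : X.IsCAT0) {a b c d x : V} (h : X.IsSquare a b c d)
    (hx : x ∈ X.halfspace a b) : x ∈ X.halfspace d c := by
  by_contra hcon
  rw [hX.notMem_halfspace h.2.2.1] at hcon
  simp only [halfspace, Set.mem_ofPred_eq, X.skeleton.dist_comm (u := x)] at hx hcon
  have h1 := hX.dist_adj h.1 x
  have h2 := hX.dist_adj h.2.1 x
  have h3 := hX.dist_adj h.2.2.1 x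
  have h4 := hX.dist_adj h.2.2.2.1 x
  obtain ⟨t, ht, ht'⟩ := hX.quadrangle (o := x) h.1.symm h.2.1 h.2.2.2.2.1 (by omega) (by omega)
  obtain rfl := ht.symm.rotate.rotate.rotate.unique h
  omega

theorem halfspace_eq_of_isSquare (hX : X.IsCAT0) {a b c d : V} (h : X.IsSquare a b c d) :
    X.halfspace a b = X.halfspace d c :=
  Set.Subset.antisymm (fun _ => hX.mem_halfspace_of_isSquare h)
    (fun _ => hX.mem_halfspace_of_isSquare h.rotate.rotate.symm.rotate.rotate.rotate)

theorem halfspace_of_eqvGen (hX : X.IsCAT0) {S : Set V} {e f : Sym2 V}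
    (h : Relation.EqvGen X.Opposite e f) :
    (∃ c d, e = s(c, d) ∧ X.skeleton.Adj c d ∧ S = X.halfspace c d) ↔
      ∃ c d, f = s(c, d) ∧ X.skeleton.Adj c d ∧ S = X.halfspace c d := by
  have key : ∀ {p q r t : V}, X.IsSquare p q r t →
      (∃ c d, s(p, q) = s(c, d) ∧ X.skeleton.Adj c d ∧ S = X.halfspace c d) →
      ∃ c d, s(t, r) = s(c, d) ∧ X.skeleton.Adj c d ∧ S = X.halfspace c d := by
    rintro p q r t h ⟨c, d, he, -, hS⟩
    rcases Sym2.eq_iff.1 he with ⟨rfl, rfl⟩ | ⟨rfl, rfl⟩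
    · exact ⟨t, r, rfl, h.2.2.1, hS.trans (hX.halfspace_eq_of_isSquare h)⟩
    · exact ⟨r, t, Sym2.eq_swap, h.2.2.1.symm, hS.trans
        (hX.halfspace_eq_of_isSquare h.symm.rotate.rotate.rotate)⟩
  induction h with
  | rel e f h =>
    obtain ⟨p, q, r, t, h, rfl, rfl⟩ := h
    exact ⟨key h, key h.rotate.rotate.symm.rotate.rotate.rotate⟩
  | refl => rfl
  | symm _ _ _ ih => exact ih.symm
  | trans _ _ _ _ _ ih ih' => exact ih.trans ih'

/-- A crossing edge slides across squares towards `a`, until it starts at `a` and must be the edge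
`a b`. -/
theorem eqvGen_of_crossing (hX : X.IsCAT0) {a b c d : V} (hab : X.skeleton.Adj a b)
    (hcd : X.skeleton.Adj c d) (hc : c ∈ X.halfspace a b) (hd : d ∉ X.halfspace a b) :
    Relation.EqvGen X.Opposite s(a, b) s(c, d) ∧ X.halfspace a b = X.halfspace c d := by
  induction hn : X.skeleton.dist c a generalizing c d with
  | zero =>
    obtain rfl := hX.1.1.dist_eq_zero_iff.1 hn
    rw [hX.notMem_halfspace hab] at hd
    have h1 := SimpleGraph.dist_eq_one_iff_adj.2 hcd.symm
    have hd' : d = b := by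
      apply hX.1.1.dist_eq_zero_iff.1
      simp only [halfspace, Set.mem_ofPred_eq] at hd
      omega
    subst hd'
    exact ⟨.refl _, rfl⟩
  | succ n ih =>
    rw [hX.notMem_halfspace hab] at hd
    simp only [halfspace, Set.mem_ofPred_eq] at hc hd
    have h1 := hX.dist_adj hcd a
    have h2 := hX.dist_adj hcd b
    have h3 := hX.dist_adj' hab c
    have h4 := hX.dist_adj' hab d
    have hne : c ≠ a := by
      rintro rfl
      simp at hn
    obtain ⟨c', hc', hn'⟩ := hX.exists_adj_dist hne
    have h5 := hX.dist_adj hc' b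
    have h6 := hX.dist_adj' hab c'
    have hdc' : d ≠ c' := by
      rintro rfl
      omega
    -- Both `d` and `c'` are nearer to `b` than `c`; the opposite edge from `c'` to `t` still
    -- crosses and is one step nearer to `a`.
    obtain ⟨t, ht, ht'⟩ := hX.quadrangle (o := b) hcd hc' hdc' (by omega) (by omega)
    have h7 := hX.dist_adj ht.2.1 a
    obtain ⟨h8, h9⟩ := ih ht.2.2.1 (by simp only [halfspace, Set.mem_ofPred_eq]; omega)
      (by simp only [halfspace, Set.mem_ofPred_eq]; omega) (by omega)
    exact ⟨h8.trans _ _ _ (.symm _ _ (.rel _ _ ⟨_, _, _, _, ht, rfl, rfl⟩)),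
      h9.trans (hX.halfspace_eq_of_isSquare ht).symm⟩

theorem halfspace_eq (hX : X.IsCAT0) {a b c d : V} (hab : X.skeleton.Adj a b)
    (hcd : X.skeleton.Adj c d) (hc : c ∈ X.halfspace a b) (hd : d ∉ X.halfspace a b) :
    X.halfspace a b = X.halfspace c d :=
  (hX.eqvGen_of_crossing hab hcd hc hd).2

/-- The hyperplane dual to an edge consists of the edges that leave the halfspace of this edge. -/
theorem eqvGen_iff (hX : X.IsCAT0) {a b c d : V} (hab : X.skeleton.Adj a b) :
    Relation.EqvGen X.Opposite s(a, b) s(c, d) ↔ X.skeleton.Adj c d ∧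
      (c ∈ X.halfspace a b ∧ d ∉ X.halfspace a b ∨
        d ∈ X.halfspace a b ∧ c ∉ X.halfspace a b) := by
  constructor
  · intro h
    obtain ⟨p, q, he, hpq, hS⟩ := (hX.halfspace_of_eqvGen h).1 ⟨a, b, rfl, hab, rfl⟩
    rw [hS]
    rcases Sym2.eq_iff.1 he with ⟨rfl, rfl⟩ | ⟨rfl, rfl⟩
    · exact ⟨hpq, Or.inl ⟨left_mem_halfspace hpq, right_notMem_halfspace _ _⟩⟩
    · exact ⟨hpq.symm, Or.inr ⟨left_mem_halfspace hpq, right_notMem_halfspace _ _⟩⟩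
  · rintro ⟨hcd, ⟨hc, hd⟩ | ⟨hd, hc⟩⟩
    · exact (hX.eqvGen_of_crossing hab hcd hc hd).1
    · rw [Sym2.eq_swap (a := c)]
      exact (hX.eqvGen_of_crossing hab hcd.symm hd hc).1

end IsCAT0

/-! ### Combinatorial hyperplanes as boundaries of halfspaces -/

/-- The vertices of the halfspace `halfspace a b` that are adjacent to its complement. -/
def halfspaceBoundary (X : CubeComplex V) (a b : V) : Set V :=
  {c | c ∈ X.halfspace a b ∧ ∃ d, X.skeleton.Adj c d ∧ d ∉ X.halfspace a b}

namespace IsCAT0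

/-- With `d'` the neighbour of `c'` across the hyperplane, both `d` and `z` are nearer to `d'` than
`c`. The resulting square carries the crossing edge from `c` to `z`, which is what makes the
boundary convex. -/
theorem exists_isSquare_of_mem_halfspaceBoundary (hX : X.IsCAT0) {a b c c' d z : V}
    (hab : X.skeleton.Adj a b) (hc : c ∈ X.halfspace a b) (hcd : X.skeleton.Adj c d)
    (hd : d ∉ X.halfspace a b) (hc' : c' ∈ X.halfspaceBoundary a b) (hz : X.skeleton.Adj c z)
    (hzc : X.skeleton.dist z c' + 1 = X.skeleton.dist c c') :
    ∃ t, X.IsSquare c d t z ∧ z ∈ X.halfspaceBoundary a b := by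
  obtain ⟨hc'1, d', hcd', hd'⟩ := hc'
  have e := hX.halfspace_eq hab hcd hc hd
  have e' := hX.halfspace_eq hab hcd' hc'1 hd'
  have h1 : c ∈ X.halfspace c' d' := e' ▸ hc
  have h2 : c' ∈ X.halfspace c d := e ▸ hc'1
  have h3 : d ∈ X.halfspace d' c' := (hX.notMem_halfspace hcd').1 (e' ▸ hd)
  simp only [halfspace, Set.mem_ofPred_eq] at h1 h2 h3
  rw [X.skeleton.dist_comm (u := c'), X.skeleton.dist_comm (u := c')] at h2
  have h4 := hX.dist_adj hcd c'
  have h5 := hX.dist_adj hcd d'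
  have h6 := hX.dist_adj' hcd' c
  have h7 := hX.dist_adj' hcd' d
  have h8 := hX.dist_adj' hcd' z
  have h9 := hX.dist_adj hz d'
  have hne : d ≠ z := by
    rintro rfl
    omega
  obtain ⟨t, ht, -⟩ := hX.quadrangle (o := d') hcd hz hne (by omega) (by omega)
  have e2 := e.trans (hX.halfspace_eq_of_isSquare ht)
  refine ⟨t, ht, ?_, t, ht.2.2.1, ?_⟩
  · rw [e2]; exact left_mem_halfspace ht.2.2.1
  · rw [e2]; exact right_notMem_halfspace _ _

theorem halfspaceBoundary_adj (hX : X.IsCAT0) {a b : V} (hab : X.skeleton.Adj a b) :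
    ∀ x ∈ X.halfspaceBoundary a b, ∀ y ∈ X.halfspaceBoundary a b, ∀ z, X.skeleton.Adj x z →
      X.skeleton.dist z y + 1 = X.skeleton.dist x y → z ∈ X.halfspaceBoundary a b := by
  rintro x ⟨hx, d, hd, hd'⟩ y hy z hz h
  obtain ⟨t, -, h1⟩ := hX.exists_isSquare_of_mem_halfspaceBoundary hab hx hd hd' hy hz h
  exact h1

end IsCAT0

/-- In a chart the edge `p q` is a coordinate direction, and changing the other coordinates one at a
time moves it through squares to an edge at `w`. -/
theorem exists_mem_of_meetsCube {e : Sym2 V} {c : Set V} (hc : c ∈ X.cubes) {p q w : V}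
    (hpq : X.skeleton.Adj p q) (hp : p ∈ c) (hq : q ∈ c)
    (he : Relation.EqvGen X.Opposite e s(p, q)) (hw : w ∈ c) :
    ∃ w' ∈ c, Relation.EqvGen X.Opposite e s(w, w') := by
  obtain ⟨ψ⟩ := nonempty_basedChart hc hp
  obtain ⟨i, rfl⟩ := ψ.exists_eq_singleton hq hpq
  have key : ∀ s : Finset (Fin ψ.n), i ∉ s →
      Relation.EqvGen X.Opposite e s(ψ.toFun s, ψ.toFun (insert i s)) := by
    intro s
    induction s using Finset.induction_on with
    | empty =>
      intro _
      rw [ψ.base]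
      exact he
    | insert j s hj ih =>
      intro hi
      simp only [Finset.mem_insert, not_or] at hi
      exact (ih hi.2).trans _ _ _ (.rel _ _ ⟨_, _, _, _, ψ.isSquare hi.1 hi.2 hj, rfl, rfl⟩)
  obtain ⟨s, rfl⟩ := ψ.exists_eq hw
  by_cases hi : i ∈ s
  · refine ⟨ψ.toFun (s.erase i), ψ.mem _, ?_⟩
    have := key (s.erase i) (Finset.notMem_erase i s)
    rwa [Finset.insert_erase hi, Sym2.eq_swap] at this
  · exact ⟨_, ψ.mem _, key s hi⟩

namespace IsCAT0

/-- At a vertex `v` of `c`, the crossing edge spans a square with each edge of `c`. Flagness then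
gives a cube that contains `c` and the crossing edge, hence meets the hyperplane. -/
theorem mem_carrierBoundary (hX : X.IsCAT0) {a b : V} (hab : X.skeleton.Adj a b) {c : Set V}
    (hc : c ∈ X.cubes) (hsub : c ⊆ X.halfspaceBoundary a b) :
    c ∈ (X.carrierBoundary {f | Relation.EqvGen X.Opposite s(a, b) f}).cubes := by
  obtain ⟨v, hv⟩ := nonempty_of_mem_cubes hc
  obtain ⟨ψ⟩ := nonempty_basedChart hc hv
  obtain ⟨hva, d, hvd, hd⟩ := hsub hv
  have hsq : ∀ i, ∃ t, X.IsSquare v d t (ψ.toFun {i}) := by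
    intro i
    have hadj := ψ.adj_base_singleton i
    obtain ⟨t, ht, -⟩ := hX.exists_isSquare_of_mem_halfspaceBoundary hab hva hvd hd
      (hsub (ψ.mem {i})) hadj (by simp [SimpleGraph.dist_eq_one_iff_adj.2 hadj])
    exact ⟨t, ht⟩
  obtain ⟨k, hk, hvk, hs⟩ := exists_cube_of_flag hX.2 (v := v)
    (s := insert d (Set.range fun i => ψ.toFun {i})) ((Set.finite_range _).insert d)
    (by
      rintro x (rfl | ⟨i, rfl⟩)
      exacts [hvd, ψ.adj_base_singleton i])
    (by
      rintro x (rfl | ⟨i, rfl⟩) y (rfl | ⟨j, rfl⟩) hxy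
      · exact absurd rfl hxy
      · obtain ⟨t, ht⟩ := hsq j
        exact ⟨_, ht.2.2.2.2.2.2, by simp, by simp, by simp⟩
      · obtain ⟨t, ht⟩ := hsq i
        exact ⟨_, ht.2.2.2.2.2.2, by simp, by simp, by simp⟩
      · exact ⟨c, hc, hv, ψ.mem _, ψ.mem _⟩)
  have hck : c ⊆ k := ψ.subset_of_base_mem hc hk hvk fun i => hs (Or.inr ⟨i, rfl⟩)
  refine ⟨⟨hc, k, hk, hck, v, hvk, d, hs (Or.inl rfl), ?_⟩, ?_⟩
  · exact (hX.eqvGen_iff hab).2 ⟨hvd, Or.inl ⟨hva, hd⟩⟩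
  · rintro ⟨p, hp, q, hq, h⟩
    rcases ((hX.eqvGen_iff hab).1 h).2 with ⟨-, h1⟩ | ⟨-, h1⟩
    · exact h1 (hsub hq).1
    · exact h1 (hsub hp).1

/-- The combinatorial hyperplanes are the full subcomplexes spanned by boundaries of halfspaces. -/
theorem mem_component_iff (hX : X.IsCAT0) {a b v : V} (hab : X.skeleton.Adj a b)
    (hv : v ∈ (X.carrierBoundary {f | Relation.EqvGen X.Opposite s(a, b) f}).verts)
    (hva : v ∈ X.halfspace a b) (c : Set V) :
    c ∈ ((X.carrierBoundary {f | Relation.EqvGen X.Opposite s(a, b) f}).component v).cubes ↔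
      c ∈ X.cubes ∧ c ⊆ X.halfspaceBoundary a b := by
  set Y := X.carrierBoundary {f | Relation.EqvGen X.Opposite s(a, b) f} with hY
  -- A path changing sides would use an edge of the hyperplane, and no cube of `Y` meets it.
  have hside : ∀ w, Y.skeleton.Reachable v w → w ∈ X.halfspace a b := by
    rintro w ⟨p⟩
    have : ∀ {x y : V}, Y.skeleton.Walk x y → x ∈ X.halfspace a b → y ∈ X.halfspace a b := by
      intro x y p
      induction p with
      | nil => exact id
      | @cons x z y e p ih =>
        refine fun hx => ih ?_
        by_contra hz
        refine e.2.2 ⟨x, by simp, z, by simp, ?_⟩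
        exact (hX.eqvGen_iff hab).2 ⟨⟨e.1, Y.subset e.2⟩, Or.inl ⟨hx, hz⟩⟩
    exact this p hva
  have hbd : ∀ c ∈ Y.cubes, ∀ w ∈ c, w ∈ X.halfspace a b → w ∈ X.halfspaceBoundary a b := by
    rintro c ⟨⟨-, k, hk, hck, p, hp, q, hq, he⟩, -⟩ w hw hwa
    obtain ⟨w', -, hw'⟩ := exists_mem_of_meetsCube hk ((hX.eqvGen_iff hab).1 he).1 hp hq he
      (hck hw)
    obtain ⟨h1, h2 | h2⟩ := (hX.eqvGen_iff hab).1 hw'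
    · exact ⟨hwa, w', h1, h2.2⟩
    · exact absurd hwa h2.2
  constructor
  · rintro ⟨hc, hreach⟩
    exact ⟨Y.subset hc, fun w hw => hbd c hc w hw (hside w (hreach w hw))⟩
  · rintro ⟨hc, hsub⟩
    refine ⟨hX.mem_carrierBoundary hab hc hsub, fun w hw => ?_⟩
    have hvb : v ∈ X.halfspaceBoundary a b := hbd _ hv v rfl hva
    suffices ∀ w ∈ X.halfspaceBoundary a b, Y.skeleton.Reachable w v from (this w (hsub hw)).symm
    intro w hw
    induction hn : X.skeleton.dist w v generalizing w with
    | zero => rw [hX.1.1.dist_eq_zero_iff.1 hn]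
    | succ n ih =>
      have hne : w ≠ v := by
        rintro rfl
        simp at hn
      obtain ⟨z, hz, hz'⟩ := hX.exists_adj_dist hne
      have hzb := hX.halfspaceBoundary_adj hab w hw v hvb z hz hz'
      have hedge : Y.skeleton.Adj w z := by
        refine ⟨hz.1, hX.mem_carrierBoundary hab hz.2 ?_⟩
        rintro x (rfl | rfl)
        exacts [hw, hzb]
      exact hedge.reachable.trans (ih z hzb (by omega))

theorem exists_of_isCombinatorialHyperplane (hX : X.IsCAT0) {Y : X.Subcomplex}
    (hY : X.IsCombinatorialHyperplane Y) : ∃ a b, X.skeleton.Adj a b ∧ Y.verts.Nonempty ∧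
      ∀ c, c ∈ Y.cubes ↔ c ∈ X.cubes ∧ c ⊆ X.halfspaceBoundary a b := by
  obtain ⟨H, ⟨e, he, rfl⟩, v, hv, rfl⟩ := hY
  induction e using Sym2.ind with
  | _ a b =>
    have hab : X.skeleton.Adj a b := he
    have hne : (((X.carrierBoundary {f | Relation.EqvGen X.Opposite s(a, b) f}).component
        v).verts).Nonempty := ⟨v, hv, by rintro w rfl; rfl⟩
    by_cases hva : v ∈ X.halfspace a b
    · exact ⟨a, b, hab, hne, hX.mem_component_iff hab hv hva⟩
    · rw [hX.notMem_halfspace hab] at hva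
      refine ⟨b, a, hab.symm, hne, ?_⟩
      rw [Sym2.eq_swap] at hv ⊢
      exact hX.mem_component_iff hab.symm hv hva

end IsCAT0

namespace Subcomplex

theorem mem_verts_of_mem {Y : X.Subcomplex} {c : Set V} (hc : c ∈ Y.cubes) {x : V} (hx : x ∈ c) :
    x ∈ Y.verts :=
  Y.face_mem c hc _ (X.singleton_mem x) (Set.singleton_subset_iff.2 hx)

theorem IsFull.mem_cubes_iff {Y : X.Subcomplex} (hY : Y.IsFull) {c : Set V} :
    c ∈ Y.cubes ↔ c ∈ X.cubes ∧ c ⊆ Y.verts :=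
  ⟨fun h => ⟨Y.subset h, fun _ hx => mem_verts_of_mem h hx⟩, fun h => hY c h.1 h.2⟩

theorem isConvex_of_mem_cubes_iff (hX : X.IsCAT0) {Y : X.Subcomplex} {S : Set V}
    (hne : Y.verts.Nonempty) (hY : ∀ c, c ∈ Y.cubes ↔ c ∈ X.cubes ∧ c ⊆ S)
    (hS : ∀ x ∈ S, ∀ y ∈ S, ∀ z, X.skeleton.Adj x z →
      X.skeleton.dist z y + 1 = X.skeleton.dist x y → z ∈ S) : Y.IsConvex := by
  have hv : Y.verts = S := by
    ext x
    exact (hY {x}).trans ⟨fun h => h.2 rfl, fun h =>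
      ⟨X.singleton_mem x, Set.singleton_subset_iff.2 h⟩⟩
  refine ⟨hne, fun c hc h => (hY c).2 ⟨hc, hv ▸ h⟩, ?_⟩
  rw [hv]
  exact fun a ha b hb z hz => hX.mem_of_forall_adj hS ha hb hz

end Subcomplex

theorem IsCAT0.isConvex_of_isCombinatorialHyperplane (hX : X.IsCAT0) {Y : X.Subcomplex}
    (hY : X.IsCombinatorialHyperplane Y) : Y.IsConvex := by
  obtain ⟨a, b, hab, hne, h⟩ := hX.exists_of_isCombinatorialHyperplane hY
  exact Subcomplex.isConvex_of_mem_cubes_iff hX hne h (hX.halfspaceBoundary_adj hab)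

end CubeComplex

namespace CubeComplex

variable {V : Type u} {X : CubeComplex V}

/-! ### Gates and gate images -/

/-- The image of a cube under an isometric map is a cube. -/
theorem IsCAT0.image_mem_cubes (hX : X.IsCAT0) {c : Set V} (hc : c ∈ X.cubes) {f : V → V}
    (hf : ∀ x ∈ c, ∀ y ∈ c, X.skeleton.dist (f x) (f y) = X.skeleton.dist x y) :
    f '' c ∈ X.cubes := by
  obtain ⟨v, hv⟩ := nonempty_of_mem_cubes hc
  obtain ⟨ψ⟩ := nonempty_basedChart hc hv
  have hadj : ∀ {x y}, x ∈ c → y ∈ c → X.skeleton.Adj x y → X.skeleton.Adj (f x) (f y) := by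
    intro x y hx hy h
    rw [← SimpleGraph.dist_eq_one_iff_adj] at h ⊢
    rw [hf x hx y hy, h]
  have hne : ∀ {x y}, x ∈ c → y ∈ c → x ≠ y → f x ≠ f y := by
    intro x y hx hy h h'
    have := hf x hx y hy
    rw [h', SimpleGraph.dist_self] at this
    exact h (hX.1.1.dist_eq_zero_iff.1 this.symm)
  have hsq : ∀ {s : Finset (Fin ψ.n)} {i j : Fin ψ.n}, i ≠ j → i ∉ s → j ∉ s →
      X.IsSquare (f (ψ.toFun s)) (f (ψ.toFun (insert i s)))
        (f (ψ.toFun (insert i (insert j s)))) (f (ψ.toFun (insert j s))) := by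
    intro s i j hij hi hj
    obtain ⟨h1, h2, h3, h4, h5, h6, -⟩ := ψ.isSquare hij hi hj
    have m := ψ.mem
    exact hX.isSquare (hadj (m _) (m _) h1) (hadj (m _) (m _) h2) (hadj (m _) (m _) h3)
      (hadj (m _) (m _) h4) (hne (m _) (m _) h5) (hne (m _) (m _) h6)
  obtain ⟨k, hk, hvk, hs⟩ := exists_cube_of_flag hX.2 (v := f v)
    (s := Set.range fun i => f (ψ.toFun {i})) (Set.finite_range _)
    (by
      rintro _ ⟨i, rfl⟩
      exact hadj hv (ψ.mem _) (ψ.adj_base_singleton i))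
    (by
      rintro _ ⟨i, rfl⟩ _ ⟨j, rfl⟩ hij
      have hij' : i ≠ j := by
        rintro rfl
        exact hij rfl
      have := hsq (s := ∅) hij' (by simp) (by simp)
      rw [ψ.base] at this
      exact ⟨_, this.2.2.2.2.2.2, by simp, by simp, by simp⟩)
  obtain ⟨ψ'⟩ := nonempty_basedChart hk hvk
  have hex : ∀ i, ∃ j, ψ'.toFun {j} = f (ψ.toFun {i}) := fun i =>
    ψ'.exists_eq_singleton (hs ⟨i, rfl⟩) (hadj hv (ψ.mem _) (ψ.adj_base_singleton i))
  choose κ hκ using hex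
  have hκinj : Function.Injective κ := by
    intro i j hij
    by_contra hcon
    refine hne (ψ.mem {i}) (ψ.mem {j}) (fun h => hcon (by simpa using ψ.inj h)) ?_
    rw [← hκ, ← hκ, hij]
  -- In the charts `f` just relabels coordinates by `κ`: three corners of a square determine the
  -- fourth, so the neighbours of the base vertex determine everything.
  have key : ∀ s : Finset (Fin ψ.n), f (ψ.toFun s) = ψ'.toFun (s.image κ) := by
    intro s
    induction s using Finset.strongInduction with
    | H s ih =>
      rcases s.eq_empty_or_nonempty with rfl | ⟨i, hi⟩
      · simp [ψ.base, ψ'.base]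
      obtain ⟨s, his, rfl⟩ : ∃ t, i ∉ t ∧ insert i t = s :=
        ⟨s.erase i, Finset.notMem_erase i s, Finset.insert_erase hi⟩
      rcases s.eq_empty_or_nonempty with rfl | ⟨j, hj⟩
      · simp [hκ]
      obtain ⟨s, hjs, rfl⟩ : ∃ t, j ∉ t ∧ insert j t = s :=
        ⟨s.erase j, Finset.notMem_erase j s, Finset.insert_erase hj⟩
      simp only [Finset.mem_insert, not_or] at his
      have hmem : ∀ {l} {t : Finset (Fin ψ.n)}, l ∉ t → κ l ∉ t.image κ := by
        intro l t hl h
        obtain ⟨l', hl', e⟩ := Finset.mem_image.1 h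
        exact hl (hκinj e ▸ hl')
      have h1 := hsq his.1 his.2 hjs
      have h2 := ψ'.isSquare (hκinj.ne his.1) (hmem his.2) (hmem hjs)
      have hss : ∀ {t u : Finset (Fin ψ.n)} {l}, l ∈ u → l ∉ t → t ⊆ u → t ⊂ u :=
        fun h h' hs => Finset.ssubset_iff_subset_ne.2 ⟨hs, fun e => h' (e ▸ h)⟩
      have e1 := ih s (hss (l := i) (by simp) his.2 (fun x hx => by simp [hx]))
      have e2 := ih (insert i s) (hss (l := j) (by simp) (by simp [Ne.symm his.1, hjs])
        (by intro x hx; simp at hx ⊢; tauto))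
      have e3 := ih (insert j s) (hss (l := i) (by simp) (by simp [his])
        (by intro x hx; simp at hx ⊢; tauto))
      rw [e1, e2, e3] at h1
      rw [← Finset.image_insert, ← Finset.image_insert, ← Finset.image_insert] at h2
      exact h1.symm.rotate.rotate.rotate.unique h2.symm.rotate.rotate.rotate
  have himg : f '' c = ψ'.toFun '' Set.Icc ∅ (Finset.univ.image κ) := by
    ext x
    constructor
    · rintro ⟨y, hy, rfl⟩
      obtain ⟨s, rfl⟩ := ψ.exists_eq hy
      exact ⟨s.image κ, ⟨Finset.empty_subset _, Finset.image_subset_image (Finset.subset_univ s)⟩,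
        (key s).symm⟩
    · rintro ⟨t, ⟨-, ht⟩, rfl⟩
      obtain ⟨s, -, rfl⟩ := Finset.subset_image_iff.1 ht
      exact ⟨ψ.toFun s, ψ.mem s, key s⟩
  rw [himg]
  exact ψ'.image_Icc_mem (Finset.empty_subset _)

namespace Subcomplex

variable {Y F F' : X.Subcomplex}

theorem IsConvex.ext (hF : F.IsConvex) (hF' : F'.IsConvex) (h : F.verts = F'.verts) : F = F' := by
  apply Subcomplex.ext
  ext c
  rw [hF.2.1.mem_cubes_iff, hF'.2.1.mem_cubes_iff, h]

theorem IsConvex.exists_isGate (hY : Y.IsConvex) (x : V) : ∃ y, Y.IsGate x y := by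
  classical
  have hex : ∃ n, ∃ y ∈ Y.verts, X.skeleton.dist x y = n := by
    obtain ⟨y, hy⟩ := hY.1
    exact ⟨_, y, hy, rfl⟩
  obtain ⟨y, hy, h⟩ := Nat.find_spec hex
  exact ⟨y, hy, fun z hz => h ▸ Nat.find_min' hex ⟨z, hz, rfl⟩⟩

/-- Induct on the distance from `z` to `y`. If the first step towards `y` led away from `x`, then
`z'` would have two neighbours nearer to `x`, namely `z` and the next vertex `w`. The quadrangle
condition then yields a vertex `t` of `Y` too near to `x` for the induction hypothesis. -/
theorem IsGate.dist_eq (hX : X.IsCAT0) (hY : Y.IsConvex) {x y : V} (h : Y.IsGate x y) {z : V}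
    (hz : z ∈ Y.verts) :
    X.skeleton.dist x z = X.skeleton.dist x y + X.skeleton.dist y z := by
  obtain ⟨hy, hmin⟩ := h
  rw [X.skeleton.dist_comm (u := x), X.skeleton.dist_comm (u := y), X.skeleton.dist_comm (u := x)]
  induction hn : X.skeleton.dist z y using Nat.strong_induction_on generalizing z with
  | _ n ih =>
    rcases Nat.eq_zero_or_pos n with rfl | hpos
    · rw [hX.1.1.dist_eq_zero_iff.1 hn, add_zero]
    have hne : z ≠ y := by
      rintro rfl
      simp at hn
      omega
    obtain ⟨z', hz', hd'⟩ := hX.exists_adj_dist hne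
    have h1 := SimpleGraph.dist_eq_one_iff_adj.2 hz'
    have hzY : z' ∈ Y.verts := hY.2.2 z hz y hy z' (by omega)
    have h2 := ih _ (by omega) hzY rfl
    rcases hX.dist_adj hz' x with h3 | h3
    · omega
    exfalso
    have h4 := hmin z hz
    rw [X.skeleton.dist_comm (u := x), X.skeleton.dist_comm (u := x)] at h4
    have hne' : z' ≠ y := by
      rintro rfl
      omega
    obtain ⟨w, hw, hdw⟩ := hX.exists_adj_dist hne'
    have h5 := SimpleGraph.dist_eq_one_iff_adj.2 hw
    have hwY : w ∈ Y.verts := hY.2.2 z' hzY y hy w (by omega)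
    have h6 := ih _ (by omega) hwY rfl
    have hzw : z ≠ w := by
      rintro rfl
      omega
    obtain ⟨t, ht, hdt⟩ := hX.quadrangle (o := x) hz'.symm hw hzw (by omega) (by omega)
    have h7 := SimpleGraph.dist_eq_one_iff_adj.2 ht.2.1
    have h8 := SimpleGraph.dist_eq_one_iff_adj.2 ht.2.2.1.symm
    have h9 := hX.1.1.dist_triangle (u := z) (v := w) (w := y)
    have h10 := hX.1.1.dist_triangle (u := z) (v := t) (w := w)
    have htY : t ∈ Y.verts := hY.2.2 z hz w hwY t (by omega)
    have h11 := hX.dist_adj ht.2.1 y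
    have h12 := hX.dist_adj ht.2.2.1 y
    have h13 := ih _ (by omega) htY rfl
    omega

theorem IsGate.unique (hX : X.IsCAT0) (hY : Y.IsConvex) {x y y' : V} (h : Y.IsGate x y)
    (h' : Y.IsGate x y') : y = y' := by
  have h1 := h.dist_eq hX hY h'.1
  have h2 := h'.2 y h.1
  exact hX.1.1.dist_eq_zero_iff.1 (by omega)

/-- The gate of the gate. -/
theorem IsGate.isGate_of_isGate (hX : X.IsCAT0) (hF : F.IsConvex) (hF' : F'.IsConvex) {x y x' : V}
    (hx : x ∈ F'.verts) (h : F.IsGate x y) (h' : F'.IsGate y x') : F.IsGate x' y := by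
  obtain ⟨y', hy'⟩ := hF.exists_isGate x'
  have h1 := h.dist_eq hX hF hy'.1
  have h2 := h'.dist_eq hX hF' hx
  have h3 := hy'.dist_eq hX hF h.1
  have h4 := hX.1.1.dist_triangle (u := x) (v := x') (w := y')
  rw [X.skeleton.dist_comm (u := y) (v := x), X.skeleton.dist_comm (u := y) (v := x'),
    X.skeleton.dist_comm (u := x') (v := x)] at h2
  rw [X.skeleton.dist_comm (u := y') (v := y)] at h3
  have : y = y' := hX.1.1.dist_eq_zero_iff.1 (by omega)
  rwa [this]

/-- Two pairs of mutual gates. -/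
theorem IsGate.dist_eq_dist (hX : X.IsCAT0) (hF : F.IsConvex) (hF' : F'.IsConvex)
    {x₁ y₁ x₂ y₂ : V} (h₁ : F.IsGate x₁ y₁) (h₁' : F'.IsGate y₁ x₁) (h₂ : F.IsGate x₂ y₂)
    (h₂' : F'.IsGate y₂ x₂) :
    X.skeleton.dist x₁ x₂ = X.skeleton.dist y₁ y₂ ∧
      X.skeleton.dist y₁ x₁ = X.skeleton.dist y₂ x₂ := by
  have e1 := h₁'.dist_eq hX hF' h₂'.1
  have e2 := h₂.dist_eq hX hF h₁.1
  have e3 := h₁.dist_eq hX hF h₂.1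
  have e4 := h₂'.dist_eq hX hF' h₁'.1
  rw [X.skeleton.dist_comm (u := x₂) (v := y₁), X.skeleton.dist_comm (u := x₂) (v := y₂),
    X.skeleton.dist_comm (u := y₂) (v := y₁)] at e2
  rw [X.skeleton.dist_comm (u := x₁) (v := y₁)] at e3
  rw [X.skeleton.dist_comm (u := y₂) (v := x₁), X.skeleton.dist_comm (u := x₂) (v := x₁)] at e4
  omega

theorem mem_verts_gate : ∀ {y : V}, y ∈ (F.gate F').verts ↔ ∃ x ∈ F'.verts, F.IsGate x y := by
  intro y
  constructor
  · rintro ⟨-, c, hc, h⟩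
    obtain ⟨x, hx, h⟩ := h y rfl
    exact ⟨x, mem_verts_of_mem hc hx, h⟩
  · rintro ⟨x, hx, h⟩
    refine ⟨X.singleton_mem y, {x}, hx, ?_⟩
    rintro _ rfl
    exact ⟨x, rfl, h⟩

theorem exists_mutual_gate (hX : X.IsCAT0) (hF : F.IsConvex) (hF' : F'.IsConvex) {y : V}
    (hy : y ∈ (F.gate F').verts) : ∃ x, F.IsGate x y ∧ F'.IsGate y x := by
  obtain ⟨x, hx, h⟩ := mem_verts_gate.1 hy
  obtain ⟨x', h'⟩ := hF'.exists_isGate y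
  exact ⟨x', h.isGate_of_isGate hX hF hF' hx h', h'⟩

/-- On vertices of the gate image, passing to the mutual gate is isometric. So it sends cubes to
cubes of `F'`, which gives fullness. -/
theorem IsConvex.gate (hX : X.IsCAT0) (hF : F.IsConvex) (hF' : F'.IsConvex) :
    (F.gate F').IsConvex := by
  refine ⟨?_, ?_, ?_⟩
  · obtain ⟨x, hx⟩ := hF'.1
    obtain ⟨y, hy⟩ := hF.exists_isGate x
    exact ⟨y, mem_verts_gate.2 ⟨x, hx, hy⟩⟩
  · intro c hc hsub
    have hex : ∀ y ∈ c, ∃ x, F.IsGate x y ∧ F'.IsGate y x := fun y hy =>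
      exists_mutual_gate hX hF hF' (hsub hy)
    choose! f hf hf' using hex
    refine ⟨hc, f '' c, hF'.2.1 _ (hX.image_mem_cubes hc fun x hx y hy => ?_) ?_, ?_⟩
    · exact ((hf x hx).dist_eq_dist hX hF hF' (hf' x hx) (hf y hy) (hf' y hy)).1
    · rintro _ ⟨y, hy, rfl⟩
      exact (hf' y hy).1
    · exact fun y hy => ⟨f y, ⟨y, hy, rfl⟩, hf y hy⟩
  · intro y₁ hy₁ y₂ hy₂ z hz
    obtain ⟨x₁, h₁, h₁'⟩ := exists_mutual_gate hX hF hF' hy₁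
    obtain ⟨x₂, h₂, h₂'⟩ := exists_mutual_gate hX hF hF' hy₂
    have hzF := hF.2.2 y₁ h₁.1 y₂ h₂.1 z hz
    -- Let `D` be the common distance of mutual gates. Projecting `z` to `F'` gives a distance at
    -- most `D`, by adding the equations for `x₁` and `x₂`; but `x` is at least `D` away from its
    -- gate `y`, which forces `y = z`.
    obtain ⟨x, hx⟩ := hF'.exists_isGate z
    obtain ⟨y, hy⟩ := hF.exists_isGate x
    obtain ⟨e1, e2⟩ := h₁.dist_eq_dist hX hF hF' h₁' h₂ h₂'
    have e3 := h₁.dist_eq hX hF hzF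
    have e4 := h₂.dist_eq hX hF hzF
    have e5 := hx.dist_eq hX hF' h₁'.1
    have e6 := hx.dist_eq hX hF' h₂'.1
    have e7 := hX.1.1.dist_triangle (u := x₁) (v := x) (w := x₂)
    have e8 := hy.dist_eq hX hF hzF
    obtain ⟨x', hx'⟩ := hF'.exists_isGate y
    have hyx' := hy.isGate_of_isGate hX hF hF' hx.1 hx'
    obtain ⟨-, e9⟩ := h₁.dist_eq_dist hX hF hF' h₁' hyx' hx'
    have e10 := hx'.2 x hx.1
    have e11 := X.skeleton.dist_comm (u := x₁) (v := z)
    have e12 := X.skeleton.dist_comm (u := x₂) (v := z)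
    have e13 := X.skeleton.dist_comm (u := y₂) (v := z)
    have e14 := X.skeleton.dist_comm (u := x₁) (v := x)
    have e15 := X.skeleton.dist_comm (u := x₁) (v := y₁)
    have e16 := X.skeleton.dist_comm (u := x₂) (v := y₂)
    have e17 := X.skeleton.dist_comm (u := x) (v := z)
    have e18 := X.skeleton.dist_comm (u := x) (v := y)
    have hyz : y = z := hX.1.1.dist_eq_zero_iff.1 (by omega)
    exact mem_verts_gate.2 ⟨x, hx.1, hyz ▸ hy⟩

/-! ### Parallel convex subcomplexes -/

/-- A convex subcomplex is contained in the gate image of every parallel one. -/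
theorem isGate_of_parallel (hX : X.IsCAT0) (hF' : F'.IsConvex)
    (hpar : X.Parallel F' F) (hF : F.IsConvex) {x y : V} (hx : x ∈ F'.verts)
    (hy : F.IsGate x y) : F'.IsGate y x := by
  obtain ⟨x', hx'⟩ := hF'.exists_isGate y
  by_cases hne : x = x'
  · rwa [hne]
  exfalso
  -- The hyperplane of the first edge from `x` to `x'` also crosses `F`, so some vertex of `F` is
  -- nearer to `x` than to `b`. Yet going through `b`, `x'` and `y` is a shortest way from `x` to
  -- any vertex of `F`.
  obtain ⟨b, hb, hb'⟩ := hX.exists_adj_dist hne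
  have h1 := SimpleGraph.dist_eq_one_iff_adj.2 hb
  have hbF : b ∈ F'.verts := hF'.2.2 x hx x' hx'.1 b (by omega)
  have hedge : ({x, b} : Set V) ∈ F'.cubes := by
    refine hF'.2.1 _ hb.2 ?_
    rintro z (rfl | rfl)
    exacts [hx, hbF]
  obtain ⟨c, hc, p, hp, q, hq, hpq⟩ := (hpar {f | Relation.EqvGen X.Opposite s(x, b) f}
    ⟨s(x, b), hb, rfl⟩).1 ⟨_, hedge, x, by simp, b, by simp, .refl _⟩
  obtain ⟨p, hp, hpx⟩ : ∃ p ∈ F.verts, p ∈ X.halfspace x b := by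
    rcases ((hX.eqvGen_iff hb).1 hpq).2 with ⟨h, -⟩ | ⟨h, -⟩
    exacts [⟨p, mem_verts_of_mem hc hp, h⟩, ⟨q, mem_verts_of_mem hc hq, h⟩]
  have h2 := hx'.dist_eq hX hF' hx
  have h3 := hy.dist_eq hX hF hp
  have h4 := hX.1.1.dist_triangle (u := b) (v := x') (w := p)
  have h5 := hX.1.1.dist_triangle (u := x') (v := y) (w := p)
  simp only [halfspace, Set.mem_ofPred_eq] at hpx
  have h6 := X.skeleton.dist_comm (u := p) (v := x)
  have h7 := X.skeleton.dist_comm (u := p) (v := b)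
  have h8 := X.skeleton.dist_comm (u := y) (v := x)
  have h9 := X.skeleton.dist_comm (u := y) (v := x')
  have h10 := X.skeleton.dist_comm (u := x') (v := x)
  omega

/-- The distance to the gate is constant along `F'`, and it vanishes at the common vertex. -/
theorem verts_subset_of_parallel (hX : X.IsCAT0) (hF' : F'.IsConvex)
    (hpar : X.Parallel F' F) (hF : F.IsConvex) {w : V} (hw : w ∈ F.verts) (hw' : w ∈ F'.verts) :
    F'.verts ⊆ F.verts := by
  intro x hx
  obtain ⟨y, hy⟩ := hF.exists_isGate x
  have hself : ∀ {Y : X.Subcomplex}, w ∈ Y.verts → Y.IsGate w w := fun h => ⟨h, by simp⟩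
  have := (hy.dist_eq_dist hX hF hF' (isGate_of_parallel hX hF' hpar hF hx hy)
    (hself hw) (hself hw')).2
  rw [SimpleGraph.dist_self] at this
  rw [← hX.1.1.dist_eq_zero_iff.1 this]
  exact hy.1

/-- Parallel convex subcomplexes with a common vertex are equal. -/
theorem eq_of_parallel (hX : X.IsCAT0) (hF' : F'.IsConvex) (hpar : X.Parallel F' F)
    (hF : F.IsConvex) {w : V} (hw : w ∈ F.verts) (hw' : w ∈ F'.verts) : F' = F :=
  hF'.ext hF ((verts_subset_of_parallel hX hF' hpar hF hw hw').antisymm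
    (verts_subset_of_parallel hX hF (fun H hH => (hpar H hH).symm) hF' hw' hw))

end Subcomplex

end CubeComplex

namespace CubeComplex

variable {V : Type u} {X : CubeComplex V} {G : Type v} [Group G] [MulAction G V]

/-! ### Equivariance under the group action -/

namespace IsCubicalAction

theorem smul_mem_iff (h : X.IsCubicalAction G) (g : G) {c : Set V} :
    g • c ∈ X.cubes ↔ c ∈ X.cubes :=
  ⟨fun hc => by simpa using h g⁻¹ _ hc, h g c⟩

theorem adj_smul (h : X.IsCubicalAction G) (g : G) {a b : V} (hab : X.skeleton.Adj a b) :
    X.skeleton.Adj (g • a) (g • b) := by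
  refine ⟨fun e => hab.1 (MulAction.injective g e), ?_⟩
  have := h g _ hab.2
  rwa [Set.smul_set_insert, Set.smul_set_singleton] at this

theorem dist_smul (h : X.IsCubicalAction G) (hX : X.skeleton.Connected) (g : G) (a b : V) :
    X.skeleton.dist (g • a) (g • b) = X.skeleton.dist a b := by
  have key : ∀ (g : G) (a b : V), X.skeleton.dist (g • a) (g • b) ≤ X.skeleton.dist a b := by
    intro g a b
    obtain ⟨p, hp⟩ := hX.exists_walk_length_eq_dist a b
    let f : X.skeleton →g X.skeleton := ⟨fun x => g • x, fun hab => h.adj_smul g hab⟩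
    have := SimpleGraph.dist_le (p.map f)
    rwa [SimpleGraph.Walk.length_map, hp] at this
  refine (key g a b).antisymm ?_
  simpa using key g⁻¹ (g • a) (g • b)

theorem isSquare_smul (h : X.IsCubicalAction G) (g : G) {a b c d : V} (hs : X.IsSquare a b c d) :
    X.IsSquare (g • a) (g • b) (g • c) (g • d) := by
  obtain ⟨h1, h2, h3, h4, h5, h6, h7⟩ := hs
  refine ⟨h.adj_smul g h1, h.adj_smul g h2, h.adj_smul g h3, h.adj_smul g h4,
    (MulAction.injective g).ne h5, (MulAction.injective g).ne h6, ?_⟩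
  have := h g _ h7
  simpa only [Set.smul_set_insert, Set.smul_set_singleton] using this

theorem eqvGen_smul (h : X.IsCubicalAction G) (g : G) {e f : Sym2 V}
    (hef : Relation.EqvGen X.Opposite e f) :
    Relation.EqvGen X.Opposite (e.map (g • ·)) (f.map (g • ·)) := by
  induction hef with
  | rel e f h' =>
    obtain ⟨a, b, c, d, hs, rfl, rfl⟩ := h'
    exact .rel _ _ ⟨_, _, _, _, h.isSquare_smul g hs, by simp, by simp⟩
  | refl => exact .refl _
  | symm _ _ _ ih => exact ih.symm
  | trans _ _ _ _ _ ih ih' => exact ih.trans _ _ _ ih'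

theorem isHyperplane_preimage (h : X.IsCubicalAction G) (g : G) {H : Set (Sym2 V)}
    (hH : X.IsHyperplane H) : X.IsHyperplane {e | e.map (g • ·) ∈ H} := by
  obtain ⟨e, he, rfl⟩ := hH
  have hinv : ∀ (g : G) (f : Sym2 V), (f.map (g⁻¹ • ·)).map (g • ·) = f := by
    intro g f
    induction f using Sym2.ind with
    | _ a b => simp
  refine ⟨e.map (g⁻¹ • ·), ?_, ?_⟩
  · induction e using Sym2.ind with
    | _ a b => exact h.adj_smul g⁻¹ he
  · ext f
    constructor
    · intro hf
      have := h.eqvGen_smul g⁻¹ hf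
      have hf' := hinv g⁻¹ f
      rw [inv_inv] at hf'
      rwa [hf'] at this
    · intro hf
      have := h.eqvGen_smul g hf
      rwa [hinv] at this

/-- The translate of a subcomplex by a group element. -/
def translate (h : X.IsCubicalAction G) (g : G) (Y : X.Subcomplex) : X.Subcomplex where
  cubes := g • Y.cubes
  subset := by
    rintro _ ⟨c, hc, rfl⟩
    exact h g c (Y.subset hc)
  face_mem := by
    rintro _ ⟨c, hc, rfl⟩ d hd hdc
    rw [Set.mem_smul_set_iff_inv_smul_mem]
    refine Y.face_mem c hc _ ((h.smul_mem_iff g⁻¹).2 hd) ?_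
    rw [Set.smul_set_subset_iff_subset_inv_smul_set, inv_inv]
    exact hdc

theorem mem_verts_translate (h : X.IsCubicalAction G) {g : G} {Y : X.Subcomplex} {x : V} :
    x ∈ (h.translate g Y).verts ↔ g⁻¹ • x ∈ Y.verts := by
  change {x} ∈ g • Y.cubes ↔ {g⁻¹ • x} ∈ Y.cubes
  rw [Set.mem_smul_set_iff_inv_smul_mem, Set.smul_set_singleton]

theorem isConvex_translate (h : X.IsCubicalAction G) (hX : X.skeleton.Connected) (g : G)
    {Y : X.Subcomplex} (hY : Y.IsConvex) : (h.translate g Y).IsConvex := by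
  refine ⟨?_, ?_, ?_⟩
  · obtain ⟨x, hx⟩ := hY.1
    exact ⟨g • x, h.mem_verts_translate.2 (by rwa [inv_smul_smul])⟩
  · intro c hc hsub
    change c ∈ g • Y.cubes
    rw [Set.mem_smul_set_iff_inv_smul_mem]
    refine hY.2.1 _ ((h.smul_mem_iff g⁻¹).2 hc) ?_
    rintro _ ⟨x, hx, rfl⟩
    exact h.mem_verts_translate.1 (hsub hx)
  · intro a ha b hb z hz
    rw [h.mem_verts_translate] at ha hb ⊢
    refine hY.2.2 _ ha _ hb _ ?_
    rwa [h.dist_smul hX, h.dist_smul hX, h.dist_smul hX]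

theorem parallel_translate (h : X.IsCubicalAction G) (g : G) {Y Z : X.Subcomplex}
    (hYZ : X.Parallel Y Z) : X.Parallel (h.translate g Y) (h.translate g Z) := by
  intro H hH
  have key : ∀ Y : X.Subcomplex, (∃ c ∈ (h.translate g Y).cubes, MeetsCube H c) ↔
      ∃ c ∈ Y.cubes, MeetsCube {e | e.map (g • ·) ∈ H} c := by
    intro Y
    constructor
    · rintro ⟨_, ⟨c, hc, rfl⟩, _, ⟨a, ha, rfl⟩, _, ⟨b, hb, rfl⟩, hab⟩
      exact ⟨c, hc, a, ha, b, hb, hab⟩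
    · rintro ⟨c, hc, a, ha, b, hb, hab⟩
      exact ⟨_, ⟨c, hc, rfl⟩, _, ⟨a, ha, rfl⟩, _, ⟨b, hb, rfl⟩, hab⟩
  rw [key, key]
  exact hYZ _ (h.isHyperplane_preimage g hH)

theorem smul_mem_halfspace (h : X.IsCubicalAction G) (hX : X.skeleton.Connected) (g : G)
    {a b x : V} : g • x ∈ X.halfspace (g • a) (g • b) ↔ x ∈ X.halfspace a b := by
  simp only [halfspace, Set.mem_ofPred_eq, h.dist_smul hX]

theorem isGate_smul (h : X.IsCubicalAction G) (hX : X.skeleton.Connected) {g : G}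
    {Y : X.Subcomplex} (hg : ∀ x, g • x ∈ Y.verts ↔ x ∈ Y.verts) {x y : V} (hxy : Y.IsGate x y) :
    Y.IsGate (g • x) (g • y) := by
  refine ⟨(hg y).2 hxy.1, fun z hz => ?_⟩
  have hz' : g⁻¹ • z ∈ Y.verts := by
    rw [← hg, smul_inv_smul]
    exact hz
  have := hxy.2 _ hz'
  rwa [← h.dist_smul hX g x y, ← h.dist_smul hX g x (g⁻¹ • z), smul_inv_smul] at this

end IsCubicalAction

namespace Subcomplex

theorem smul_mem_verts_iff {Y : X.Subcomplex} {g : G} (hg : g ∈ Y.stabilizer) (x : V) :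
    g • x ∈ Y.verts ↔ x ∈ Y.verts := by
  have hg' : g • Y.cubes = Y.cubes := hg
  change {g • x} ∈ Y.cubes ↔ {x} ∈ Y.cubes
  conv_lhs => rw [← hg', ← Set.smul_set_singleton, Set.smul_mem_smul_set_iff]

theorem mem_stabilizer (h : X.IsCubicalAction G) {Y : X.Subcomplex} (hY : Y.IsFull) {g : G}
    (hg : ∀ x, g • x ∈ Y.verts ↔ x ∈ Y.verts) : g ∈ Y.stabilizer := by
  change g • Y.cubes = Y.cubes
  ext c
  rw [Set.mem_smul_set_iff_inv_smul_mem, hY.mem_cubes_iff, hY.mem_cubes_iff, h.smul_mem_iff]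
  refine and_congr_right fun _ => ⟨fun hc x hx => ?_, ?_⟩
  · rw [← smul_inv_smul g x, hg]
    exact hc (Set.smul_mem_smul_set hx)
  · rintro hc _ ⟨x, hx, rfl⟩
    change g⁻¹ • x ∈ _
    rw [← hg, smul_inv_smul]
    exact hc hx

end Subcomplex

/-! ### Cocompactness of stabilisers -/

/-- The vertices of a cocompact subcomplex fall into finitely many orbits. -/
theorem ActsCocompactly.exists_finite {S : Subgroup G} {Y : X.Subcomplex}
    (h : ActsCocompactly S Y) :
    ∃ P : Set V, P.Finite ∧ ∀ x ∈ Y.verts, ∃ g ∈ S, ∃ p ∈ P, x = g • p := by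
  obtain ⟨K, hK, hKY, hcov⟩ := h
  refine ⟨⋃₀ K, hK.sUnion fun c hc => finite_of_mem_cubes (Y.subset (hKY hc)), ?_⟩
  intro x hx
  obtain ⟨g, hg, k, hk, e⟩ := hcov _ hx
  obtain ⟨p, hp, e'⟩ : x ∈ g • k := e ▸ rfl
  exact ⟨g, hg, p, ⟨k, hk, hp⟩, e'.symm⟩

/-- A stabiliser acts cocompactly if the vertices fall into finitely many types and vertices of the
same type are in the same orbit. -/
theorem actsCocompactly_of_types (hproper : X.IsProper) {Y : X.Subcomplex} {τ : Type*} {T : Set τ}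
    (hT : T.Finite) (ρ : V → τ → Prop) (hex : ∀ x ∈ Y.verts, ∃ t ∈ T, ρ x t)
    (horb : ∀ x ∈ Y.verts, ∀ y ∈ Y.verts, ∀ t, ρ x t → ρ y t →
      ∃ g ∈ (Y.stabilizer : Subgroup G), g • x = y) :
    ActsCocompactly (Y.stabilizer : Subgroup G) Y := by
  have hrep : ∀ t ∈ {t ∈ T | ∃ x ∈ Y.verts, ρ x t}, ∃ x, x ∈ Y.verts ∧ ρ x t :=
    fun t ht => ht.2
  rcases Y.verts.eq_empty_or_nonempty with hY | ⟨v, -⟩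
  · refine ⟨∅, Set.finite_empty, Set.empty_subset _, fun c hc => ?_⟩
    obtain ⟨x, hx⟩ := nonempty_of_mem_cubes (Y.subset hc)
    exact absurd (Subcomplex.mem_verts_of_mem hc hx) (hY ▸ Set.notMem_empty x)
  have : Nonempty V := ⟨v⟩
  choose! r hr using hrep
  have hT' : {t ∈ T | ∃ x ∈ Y.verts, ρ x t}.Finite := hT.subset fun t ht => ht.1
  -- Take all cubes of `Y` at one representative vertex for each type that occurs; local finiteness
  -- keeps this finite.
  refine ⟨⋃ t ∈ {t ∈ T | ∃ x ∈ Y.verts, ρ x t}, {c ∈ X.cubes | r t ∈ c} ∩ Y.cubes,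
    hT'.biUnion fun t _ => (hproper (r t)).inter_of_left _, ?_, ?_⟩
  · exact Set.iUnion₂_subset fun t _ => Set.inter_subset_right
  · intro c hc
    obtain ⟨x, hx⟩ := nonempty_of_mem_cubes (Y.subset hc)
    have hxY := Subcomplex.mem_verts_of_mem hc hx
    obtain ⟨t, ht, hxt⟩ := hex x hxY
    have ht' : t ∈ {t ∈ T | ∃ x ∈ Y.verts, ρ x t} := ⟨ht, x, hxY, hxt⟩
    obtain ⟨g, hg, rfl⟩ := horb _ (hr t ht').1 x hxY t (hr t ht').2 hxt
    have hgc : g⁻¹ • c ∈ Y.cubes := by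
      rw [← Set.mem_smul_set_iff_inv_smul_mem]
      rw [show g • Y.cubes = Y.cubes from hg]
      exact hc
    refine ⟨g, hg, g⁻¹ • c, Set.mem_biUnion ht' ⟨⟨Y.subset hgc, ?_⟩, hgc⟩,
      (smul_inv_smul g c).symm⟩
    rwa [Set.mem_inv_smul_set_iff]

theorem finite_closedBall (hX : X.skeleton.Connected) (hproper : X.IsProper) (v : V) (n : ℕ) :
    {x | X.skeleton.dist v x ≤ n}.Finite := by
  induction n generalizing v with
  | zero =>
    refine (Set.finite_singleton v).subset fun x hx => ?_
    exact (hX.dist_eq_zero_iff.1 (Nat.le_zero.1 hx)).symm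
  | succ n ih =>
    have hN : (X.skeleton.neighborSet v).Finite := by
      refine ((hproper v).biUnion fun c hc => finite_of_mem_cubes hc.1).subset ?_
      intro w hw
      exact Set.mem_biUnion (x := {v, w}) ⟨hw.2, by simp⟩ (by simp)
    refine ((Set.finite_singleton v).union (hN.biUnion fun w _ => ih w)).subset ?_
    intro x hx
    obtain ⟨p, hp⟩ := hX.exists_walk_length_eq_dist v x
    cases p with
    | nil => exact Or.inl rfl
    | @cons _ w _ e p =>
      refine Or.inr (Set.mem_biUnion (x := w) e ?_)
      have := SimpleGraph.dist_le p
      rw [SimpleGraph.Walk.length_cons] at hp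
      simp only [Set.mem_ofPred_eq] at hx ⊢
      omega

theorem actsCocompactly_of_isCombinatorialHyperplane (hX : X.IsCAT0) (hproper : X.IsProper)
    (hcub : X.IsCubicalAction G)
    (hcocompact : ActsCocompactly (⊤ : Subgroup G) X.whole) {Y : X.Subcomplex}
    (hY : X.IsCombinatorialHyperplane Y) : ActsCocompactly (Y.stabilizer : Subgroup G) Y := by
  have hconv := hX.isConvex_of_isCombinatorialHyperplane hY
  obtain ⟨a, b, hab, -, hmem⟩ := hX.exists_of_isCombinatorialHyperplane hY
  have hverts : ∀ x, x ∈ Y.verts ↔ x ∈ X.halfspaceBoundary a b := fun x =>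
    (hmem {x}).trans ⟨fun h => h.2 rfl, fun h =>
      ⟨X.singleton_mem x, Set.singleton_subset_iff.2 h⟩⟩
  obtain ⟨K, hK, hKX, hcov⟩ := hcocompact
  have hP : (⋃₀ K).Finite := hK.sUnion fun c hc => finite_of_mem_cubes (hKX hc)
  refine actsCocompactly_of_types hproper (hP.prod hP)
    (fun x t => ∃ (g : G) (d : V), X.skeleton.Adj x d ∧ x ∈ X.halfspace a b ∧
      d ∉ X.halfspace a b ∧ g • t.1 = x ∧ g • t.2 = d) ?_ ?_
  · intro x hx
    obtain ⟨hxa, d, hxd, hd⟩ := (hverts x).1 hx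
    obtain ⟨g, -, k, hk, e⟩ := hcov {x, d} hxd.2
    obtain ⟨p, hp, hpx⟩ : x ∈ g • k := e ▸ by simp
    obtain ⟨q, hq, hqd⟩ : d ∈ g • k := e ▸ by simp
    exact ⟨(p, q), ⟨⟨k, hk, hp⟩, ⟨k, hk, hq⟩⟩, g, d, hxd, hxa, hd, hpx, hqd⟩
  · rintro x hx y hy ⟨p, q⟩ ⟨g, d, hxd, hxa, hd, hpx, hqd⟩ ⟨g', d', hyd, hya, hd', hpy, hqd'⟩
    refine ⟨g' * g⁻¹, Subcomplex.mem_stabilizer hcub hconv.2.1 fun z => ?_, ?_⟩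
    · have hgx : (g' * g⁻¹) • x = y := by rw [← hpx, mul_smul, inv_smul_smul, hpy]
      have hgd : (g' * g⁻¹) • d = d' := by rw [← hqd, mul_smul, inv_smul_smul, hqd']
      -- The element carries one edge leaving the halfspace to another, in the same direction, and
      -- each of these edges determines that halfspace.
      have hside : ∀ z, (g' * g⁻¹) • z ∈ X.halfspace a b ↔ z ∈ X.halfspace a b := by
        intro z
        rw [← hcub.smul_mem_halfspace hX.1.1 (g' * g⁻¹) (a := a) (x := z)]
        rw [hcub.smul_mem_halfspace hX.1.1, hX.halfspace_eq hab hxd hxa hd,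
          ← hcub.smul_mem_halfspace hX.1.1 (g' * g⁻¹) (x := z), hgx, hgd,
          ← hX.halfspace_eq hab hyd hya hd', hX.halfspace_eq hab hxd hxa hd]
      rw [hverts, hverts]
      refine and_congr (hside z) ⟨?_, ?_⟩
      · rintro ⟨w, hw, hw'⟩
        refine ⟨(g' * g⁻¹)⁻¹ • w, ?_, ?_⟩
        · simpa only [inv_smul_smul] using hcub.adj_smul (g' * g⁻¹)⁻¹ hw
        · rwa [← hside, smul_inv_smul]
      · rintro ⟨w, hw, hw'⟩
        exact ⟨(g' * g⁻¹) • w, hcub.adj_smul _ hw, fun h => hw' ((hside w).1 h)⟩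
    · rw [← hpx, mul_smul, inv_smul_smul]
      exact hpy

theorem actsCocompactly_gate (hX : X.IsCAT0) (hproper : X.IsProper)
    (hcub : X.IsCubicalAction G)
    (hG : IsProperAction V G) {F F' : X.Subcomplex} (hF : F.IsConvex)
    (hF' : F'.IsConvex) (h : ActsCocompactly (F.stabilizer : Subgroup G) F)
    (h' : ActsCocompactly (F'.stabilizer : Subgroup G) F') :
    ActsCocompactly ((F.gate F').stabilizer : Subgroup G) (F.gate F') := by
  obtain ⟨P, hP, hcov⟩ := h.exists_finite
  obtain ⟨Q, hQ, hcov'⟩ := h'.exists_finite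
  obtain ⟨y₀, hy₀⟩ := (hF.gate hX hF').1
  obtain ⟨x₀, h₀, h₀'⟩ := Subcomplex.exists_mutual_gate hX hF hF' hy₀
  set D := X.skeleton.dist y₀ x₀ with hD
  -- Large enough that `(g⁻¹ * g') • q` lies both in `K` and in the translate of `K`, so properness
  -- of the action leaves finitely many `g⁻¹ * g'`.
  set K : Set V := Q ∪ ⋃ p ∈ P, {x | X.skeleton.dist p x ≤ D} with hK
  have hKfin : K.Finite := hQ.union (hP.biUnion fun p _ => finite_closedBall hX.1.1 hproper p D)
  refine actsCocompactly_of_types hproper (hP.prod (hG K hKfin))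
    (fun y t => ∃ g ∈ (F.stabilizer : Subgroup G), ∃ g' ∈ (F'.stabilizer : Subgroup G),
      y = g • t.1 ∧ g⁻¹ * g' = t.2) ?_ ?_
  · intro y hy
    obtain ⟨x, hx, hx'⟩ := Subcomplex.exists_mutual_gate hX hF hF' hy
    obtain ⟨g, hg, p, hp, rfl⟩ := hcov y hx.1
    obtain ⟨g', hg', q, hq, rfl⟩ := hcov' x hx'.1
    refine ⟨(p, g⁻¹ * g'), ⟨hp, (g⁻¹ * g') • q, ?_, ?_⟩, g, hg, g', hg', rfl, rfl⟩
    · exact Set.smul_mem_smul_set (Or.inl hq)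
    · refine Or.inr (Set.mem_biUnion hp ?_)
      have h1 := (hx.dist_eq_dist hX hF hF' hx' h₀ h₀').2
      have h2 := hcub.dist_smul hX.1.1 g p ((g⁻¹ * g') • q)
      rw [← mul_smul, mul_inv_cancel_left] at h2
      exact (h2.symm.trans h1).le
  · rintro _ - _ - ⟨p, γ⟩ ⟨g, hg, g', hg', rfl, hγ⟩ ⟨k, hk, k', hk', rfl, hγ'⟩
    dsimp only at hγ hγ'
    -- Equal second components give one element with two descriptions, through `F` and through `F'`;
    -- it therefore stabilises both.
    have he : k * g⁻¹ = k' * g'⁻¹ := by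
      have h1 : g' = g * γ := by rw [← hγ, mul_inv_cancel_left]
      have h2 : k' = k * γ := by rw [← hγ', mul_inv_cancel_left]
      rw [h1, h2]
      group
    have hm : k * g⁻¹ ∈ (F.stabilizer : Subgroup G) := mul_mem hk (inv_mem hg)
    have hm' : k * g⁻¹ ∈ (F'.stabilizer : Subgroup G) := he ▸ mul_mem hk' (inv_mem hg')
    have key : ∀ m : G, m ∈ (F.stabilizer : Subgroup G) → m ∈ (F'.stabilizer : Subgroup G) →
        ∀ y ∈ (F.gate F').verts, m • y ∈ (F.gate F').verts := by
      intro m hm hm' y hy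
      obtain ⟨x, hx, hxy⟩ := Subcomplex.mem_verts_gate.1 hy
      exact Subcomplex.mem_verts_gate.2 ⟨m • x, (Subcomplex.smul_mem_verts_iff hm' x).2 hx,
        hcub.isGate_smul hX.1.1 (Subcomplex.smul_mem_verts_iff hm) hxy⟩
    refine ⟨k * g⁻¹, Subcomplex.mem_stabilizer hcub (hF.gate hX hF').2.1 fun z =>
      ⟨fun hz => ?_, key _ hm hm' z⟩, ?_⟩
    · simpa only [inv_smul_smul] using key _ (inv_mem hm) (inv_mem hm') _ hz
    · change (k * g⁻¹) • g • p = k • p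
      rw [mul_smul, inv_smul_smul]

theorem actsCocompactly_of_parallel (hX : X.IsCAT0) (hproper : X.IsProper)
    (hcub : X.IsCubicalAction G)
    {F F' : X.Subcomplex} (hF : F.IsConvex) (hF' : F'.IsConvex)
    (hpar : X.Parallel F' F) (h : ActsCocompactly (F.stabilizer : Subgroup G) F) :
    ActsCocompactly (F'.stabilizer : Subgroup G) F' := by
  obtain ⟨P, hP, hcov⟩ := h.exists_finite
  obtain ⟨x₀, hx₀⟩ := hF'.1
  obtain ⟨y₀, h₀⟩ := hF.exists_isGate x₀
  have h₀' := Subcomplex.isGate_of_parallel hX hF' hpar hF hx₀ h₀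
  set D := X.skeleton.dist y₀ x₀ with hD
  have hfin : (⋃ p ∈ P, {x | X.skeleton.dist p x ≤ D}).Finite :=
    hP.biUnion fun p _ => finite_closedBall hX.1.1 hproper p D
  -- The type of `x` is a translate of `x` itself by `Stab F`, chosen near a representative of its
  -- gate.
  refine actsCocompactly_of_types hproper hfin
    (fun x w => ∃ g ∈ (F.stabilizer : Subgroup G), x = g • w) ?_ ?_
  · intro x hx
    obtain ⟨y, hy⟩ := hF.exists_isGate x
    have hy' := Subcomplex.isGate_of_parallel hX hF' hpar hF hx hy
    obtain ⟨g, hg, p, hp, rfl⟩ := hcov y hy.1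
    refine ⟨g⁻¹ • x, Set.mem_biUnion hp ?_, g, hg, (smul_inv_smul g x).symm⟩
    have h1 := (hy.dist_eq_dist hX hF hF' hy' h₀ h₀').2
    have h2 := hcub.dist_smul hX.1.1 g p (g⁻¹ • x)
    rw [smul_inv_smul] at h2
    exact (h2.symm.trans h1).le
  · rintro _ hx _ hy w ⟨g, hg, rfl⟩ ⟨k, hk, rfl⟩
    have hm : k * g⁻¹ ∈ (F.stabilizer : Subgroup G) := mul_mem hk (inv_mem hg)
    have hmx : (k * g⁻¹) • g • w = k • w := by rw [mul_smul, inv_smul_smul]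
    refine ⟨k * g⁻¹, ?_, hmx⟩
    have hFeq : hcub.translate (k * g⁻¹) F = F := Subcomplex.ext hm
    -- The translate of `F'` is parallel to the translate of `F`, which is `F`, and so to `F'`.
    have hp : X.Parallel (hcub.translate (k * g⁻¹) F') F' := by
      have := hcub.parallel_translate (k * g⁻¹) hpar
      rw [hFeq] at this
      exact fun H hH => (this H hH).trans (hpar H hH).symm
    have heq := Subcomplex.eq_of_parallel hX (hcub.isConvex_translate hX.1.1 (k * g⁻¹) hF') hp hF'
      hy (hcub.mem_verts_translate.2 (by rwa [← hmx, inv_smul_smul]))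
    exact congrArg Subcomplex.cubes heq

theorem isHyperclosed_cocompact (hX : X.IsCAT0) (hproper : X.IsProper)
    (hcub : X.IsCubicalAction G)
    (hG : IsProperAction V G)
    (hcocompact : ActsCocompactly (⊤ : Subgroup G) X.whole) :
    X.IsHyperclosed {F | F.IsConvex ∧ ActsCocompactly (F.stabilizer : Subgroup G) F} where
  convex _ hF := hF.1
  whole_mem := by
    have : Nonempty V := hX.1.1.nonempty
    refine ⟨⟨⟨Classical.arbitrary V, X.singleton_mem _⟩, fun c hc _ => hc,
      fun _ _ _ _ z _ => X.singleton_mem z⟩, ?_⟩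
    obtain ⟨K, hK, hKX, hcov⟩ := hcocompact
    refine ⟨K, hK, hKX, fun c hc => ?_⟩
    obtain ⟨g, -, k, hk, e⟩ := hcov c hc
    exact ⟨g, Subcomplex.mem_stabilizer hcub (fun c hc _ => hc) fun x =>
      iff_of_true (X.singleton_mem _) (X.singleton_mem _), k, hk, e⟩
  hyperplane_mem H hH := ⟨hX.isConvex_of_isCombinatorialHyperplane hH,
    actsCocompactly_of_isCombinatorialHyperplane hX hproper hcub hcocompact hH⟩
  gate_mem F hF F' hF' := ⟨hF.1.gate hX hF'.1,
    actsCocompactly_gate hX hproper hcub hG hF.1 hF'.1 hF.2 hF'.2⟩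
  parallel_mem F hF F' hF' hpar := ⟨hF', actsCocompactly_of_parallel hX hproper hcub hF.1 hF' hpar
    hF.2⟩

end CubeComplex

theorem mainTheorem10 {V : Type u} (X : CubeComplex V) (hX : X.IsCAT0) (hproper : X.IsProper)
    {G : Type v} [Group G] [MulAction G V] (hcub : X.IsCubicalAction G)
    (hG : CubeComplex.IsProperAction V G)
    (hcocompact : CubeComplex.ActsCocompactly (⊤ : Subgroup G) X.whole) :
    (∀ n : ℕ, 1 ≤ n → ∀ F ∈ X.grade n,
      CubeComplex.ActsCocompactly (F.stabilizer : Subgroup G) F) ∧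
    ∀ F ∈ X.hyperclosure, CubeComplex.ActsCocompactly (F.stabilizer : Subgroup G) F := by
  have key : ∀ F ∈ X.hyperclosure, CubeComplex.ActsCocompactly (F.stabilizer : Subgroup G) F :=
    fun F hF => (hF _ (CubeComplex.isHyperclosed_cocompact hX hproper hcub hG hcocompact)).2
  refine ⟨fun n hn F hF => key F ?_, key⟩
  obtain ⟨m, rfl⟩ := Nat.exists_eq_add_of_le' hn
  exact hF.1
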